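/- **Definitions.** All algebras are over $\mathbb{C}$. A *finite Hopf C\*-algebra* is a finite-dimensional unital C\*-algebra $A$ that is also a Hopf algebra $(A,\Delta,\varepsilon,S)$ such that $\Delta:A\to A\otimes A$ and $\varepsilon:A\to\mathbb{C}$ are unital $*$-homomorphisms and $S(S(a)^*)^*=a$ for all $a\in A$. An *invariant integral* on $A$ is a linear functional $\varphi$ with $(\varphi\otimes\iota)\Delta(a)=(\iota\otimes\varphi)\Delta(a)=\varphi(a)1$ and $\varphi(S(a))=\varphi(a)$ for all $a$, and with $\varphi(1)>0$. A *pairing* of finite Hopf C\*-algebras $A,B$ is a bilinear form $\langle\cdot,\cdot\rangle:A\times B\to\mathbb{C}$ such that, with $\langle a_1\otimes a_2,b_1\otimes b_2\rangle=\langle a_1,b_1\rangle\langle a_2,b_2\rangle$, $$\langle\Delta(a),b_1\otimes b_2\rangle=\langle a,b_1b_2\rangle,\quad \langle a_1\otimes a_2,\Delta(b)\rangle=\langle a_1a_2,b\rangle,\quad \langle a^*,b\rangle=\overline{\langle a,S(b)^*\rangle},$$ $$\langle a,1\rangle=\varepsilon(a),\quad \langle 1,b\rangle=\varepsilon(b),\quad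 \langle S(a),b\rangle=\langle a,S(b)\rangle .$$ It is *non-degenerate* if $\langle a,b\rangle=0$ for all $b\in B$ forces $a=0$, and $\langle a,b\rangle=0$ for all $a\in A$ forces $b=0$. The *quantum double* $D(A,B)$ of a non-degenerate pairing is the vector space $A\otimes B$, with $(a,b):=a\otimes b$, unit $(1,1)$, and the following operations, written in Sweedler notation and extended linearly (anti-linearly for $*$): $$(a,b)(a',b')=\sum\langle a'_{(1)},S^{-1}(b_{(3)})\rangle\,\langle a'_{(3)},b_{(1)}\rangle\;(a\,a'_{(2)},\,b_{(2)}b'),$$ $$(a,b)^*=(1,b^*)(a^*,1),\qquad \Delta_D(a,b)=\sum (a_{(2)},b_{(1)})\otimes(a_{(1)},b_{(2)}),$$ $$\varepsilon_D(a,b)=\varepsilon(a)\varepsilon(b),\qquad S_D(a,b)=(1,S(b))(S(a),1).$$ **Theorem 3.8.** Let $(A,B,\langle\cdot,\cdot\rangle)$ be a non-degenerate pairing of finite Hopf C\*-algebras. Then $A$ and $B$ have invariant integrals, and there is a norm on $D(A,B)$ which, together with the operations above, makes $D(A,B)$ a finite Hopf C\*-algebra. Moreover, for all invariant integrals $\varphi_A$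 on $A$ and $\varphi_B$ on $B$, the functional $\theta=\varphi_A\otimes\varphi_B$, $\theta(a,b)=\varphi_A(a)\varphi_B(b)$, is a faithful positive linear functional on $D(A,B)$, and this norm is the one given by the GNS representation of $\theta$: if $K$ is the Hilbert space $D(A,B)$ with inner product $\langle x,y\rangle_\theta=\theta(y^*x)$, and $\pi(d)x=dx$, then $\pi:D(A,B)\to B(K)$ is a unital $*$-homomorphism and $\|d\|=\|\pi(d)\|$ (operator norm) for all $d\in D(A,B)$. -/

import Mathlib

open scoped TensorProduct ComplexOrder
open Coalgebra HopfAlgebra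

universe u v

/-- A finite Hopf C*-algebra: a finite dimensional unital C*-algebra `A` which is a Hopf algebra
over `ℂ` (same multiplication and linear structure), whose comultiplication `A → A ⊗ A` and counit
`A → ℂ` are `*`-maps (they are unital algebra homomorphisms by the bialgebra axioms), and whose
antipode satisfies `S (S(a)^*)^* = a`. The involution of `A ⊗ A` is `(a ⊗ b)^* = a^* ⊗ b^*`. -/
class FiniteHopfCStarAlgebra (A : Type u) extends CStarAlgebra A, HopfAlgebra ℂ A where
  finite_dim : FiniteDimensional ℂ A
  comul_star : ∀ a : A, Coalgebra.comul (R := ℂ) (Star.star a) =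
    Star.star (Coalgebra.comul (R := ℂ) a)
  counit_star : ∀ a : A, Coalgebra.counit (R := ℂ) (Star.star a) =
    Star.star (Coalgebra.counit (R := ℂ) a)
  star_antipode_star_antipode : ∀ a : A,
    Star.star (HopfAlgebra.antipode ℂ (Star.star (HopfAlgebra.antipode ℂ a))) = a

/-- The antipode `S` as a linear bijection; its inverse is `a ↦ S(a^*)^*`. -/
noncomputable def antipodeEquiv (A : Type u) [FiniteHopfCStarAlgebra A] : A ≃ₗ[ℂ] A where
  __ := antipode ℂ (A := A)
  invFun a := star (antipode ℂ (star a))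
  left_inv a := FiniteHopfCStarAlgebra.star_antipode_star_antipode a
  right_inv a := star_injective (by
    exact FiniteHopfCStarAlgebra.star_antipode_star_antipode (star a))

/-- `φ` is an invariant functional on `A`:
`(φ ⊗ ι) Δ(a) = φ(a) 1 = (ι ⊗ φ) Δ(a)` and `φ ∘ S = φ`. -/
structure IsInvariantFunctional {A : Type u} [FiniteHopfCStarAlgebra A] (φ : A →ₗ[ℂ] ℂ) :
    Prop where
  left_inv : ∀ a : A, TensorProduct.lid ℂ A (φ.rTensor A (comul (R := ℂ) a)) = φ a • (1 : A)
  right_inv : ∀ a : A, TensorProduct.rid ℂ A (φ.lTensor A (comul (R := ℂ) a)) = φ a • (1 : A)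
  antipode_inv : ∀ a : A, φ (antipode ℂ a) = φ a

/-- An invariant integral: an invariant functional `φ` with `φ(1) > 0`, i.e. a positive multiple
of the normalised one. -/
structure IsInvariantIntegral {A : Type u} [FiniteHopfCStarAlgebra A] (φ : A →ₗ[ℂ] ℂ) : Prop
    extends IsInvariantFunctional φ where
  one_pos : 0 < φ 1

/-- The bilinear form `⟨a₁ ⊗ a₂, b₁ ⊗ b₂⟩ = ⟨a₁, b₁⟩ ⟨a₂, b₂⟩`. -/
noncomputable def tensorForm {A : Type u} {B : Type v} [AddCommGroup A] [Module ℂ A]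
    [AddCommGroup B] [Module ℂ B] (f : A →ₗ[ℂ] B →ₗ[ℂ] ℂ) :
    (A ⊗[ℂ] A) →ₗ[ℂ] (B ⊗[ℂ] B) →ₗ[ℂ] ℂ :=
  (TensorProduct.map₂ f f).compr₂ (LinearMap.mul' ℂ ℂ)

/-- A pairing of finite Hopf C*-algebras. -/
structure HopfPairing (A : Type u) (B : Type v) [FiniteHopfCStarAlgebra A]
    [FiniteHopfCStarAlgebra B] where
  form : A →ₗ[ℂ] B →ₗ[ℂ] ℂ
  form_comul_left : ∀ (a : A) (b₁ b₂ : B),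
    tensorForm form (comul a) (b₁ ⊗ₜ[ℂ] b₂) = form a (b₁ * b₂)
  form_comul_right : ∀ (a₁ a₂ : A) (b : B),
    tensorForm form (a₁ ⊗ₜ[ℂ] a₂) (comul b) = form (a₁ * a₂) b
  form_star : ∀ (a : A) (b : B), form (star a) b = star (form a (star (antipode ℂ b)))
  form_one_right : ∀ a : A, form a 1 = counit a
  form_one_left : ∀ b : B, form 1 b = counit b
  form_antipode : ∀ (a : A) (b : B), form (antipode ℂ a) b = form a (antipode ℂ b)

/-- The iterated comultiplication `a ↦ ∑ a₍₁₎ ⊗ (a₍₂₎ ⊗ a₍₃₎)`. -/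
noncomputable def comulThree (A : Type u) [FiniteHopfCStarAlgebra A] :
    A →ₗ[ℂ] A ⊗[ℂ] (A ⊗[ℂ] A) :=
  (comul (R := ℂ)).lTensor A ∘ₗ comul

/-- The opposite comultiplication `a ↦ ∑ a₍₂₎ ⊗ a₍₁₎`. -/
noncomputable def comulOp (A : Type u) [FiniteHopfCStarAlgebra A] : A →ₗ[ℂ] A ⊗[ℂ] A :=
  (TensorProduct.comm ℂ A A).toLinearMap ∘ₗ comul

/-- The iterated opposite comultiplication `a ↦ ∑ a₍₃₎ ⊗ (a₍₂₎ ⊗ a₍₁₎)`. -/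
noncomputable def comulThreeOp (A : Type u) [FiniteHopfCStarAlgebra A] :
    A →ₗ[ℂ] A ⊗[ℂ] (A ⊗[ℂ] A) :=
  (comulOp A).lTensor A ∘ₗ comulOp A

namespace HopfPairing

variable {A : Type u} {B : Type v} [FiniteHopfCStarAlgebra A] [FiniteHopfCStarAlgebra B]

/-- Each of the two algebras separates the points of the other. -/
def Nondegenerate (P : HopfPairing A B) : Prop :=
  (∀ a : A, (∀ b : B, P.form a b = 0) → a = 0) ∧ (∀ b : B, (∀ a : A, P.form a b = 0) → b = 0)

/-- The linear map `a₁ ⊗ (a₂ ⊗ a₃) ⊗ (b₃ ⊗ (b₂ ⊗ b₁)) ↦ ⟨a₁, S⁻¹ b₃⟩ ⟨a₃, b₁⟩ a₂ ⊗ b₂`. -/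
noncomputable def contract (P : HopfPairing A B) :
    (A ⊗[ℂ] (A ⊗[ℂ] A)) ⊗[ℂ] (B ⊗[ℂ] (B ⊗[ℂ] B)) →ₗ[ℂ] A ⊗[ℂ] B :=
  (TensorProduct.lid ℂ (A ⊗[ℂ] B)).toLinearMap ∘ₗ
    TensorProduct.map
      (TensorProduct.lift (P.form.compl₂ (antipodeEquiv B).symm.toLinearMap))
      ((TensorProduct.rid ℂ (A ⊗[ℂ] B)).toLinearMap ∘ₗ
        (TensorProduct.lift P.form).lTensor (A ⊗[ℂ] B) ∘ₗ
        (TensorProduct.tensorTensorTensorComm ℂ A A B B).toLinearMap) ∘ₗ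
    (TensorProduct.tensorTensorTensorComm ℂ A (A ⊗[ℂ] A) B (B ⊗[ℂ] B)).toLinearMap

theorem contract_tmul (P : HopfPairing A B) (a₁ a₂ a₃ : A) (b₁ b₂ b₃ : B) :
    P.contract ((a₁ ⊗ₜ[ℂ] (a₂ ⊗ₜ[ℂ] a₃)) ⊗ₜ[ℂ] (b₃ ⊗ₜ[ℂ] (b₂ ⊗ₜ[ℂ] b₁))) =
      (P.form a₁ ((antipodeEquiv B).symm b₃) * P.form a₃ b₁) • (a₂ ⊗ₜ[ℂ] b₂) := by
  simp [contract, TensorProduct.smul_tmul', mul_smul]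

/-- The exchange map
`b ⊗ a ↦ ∑ ⟨a₍₁₎, S⁻¹ b₍₃₎⟩ ⟨a₍₃₎, b₍₁₎⟩ a₍₂₎ ⊗ b₍₂₎`,
which gives the product `(1, b)(a, 1)` in the quantum double. -/
noncomputable def exchange (P : HopfPairing A B) : B ⊗[ℂ] A →ₗ[ℂ] A ⊗[ℂ] B :=
  P.contract ∘ₗ TensorProduct.map (comulThree A) (comulThreeOp B) ∘ₗ
    (TensorProduct.comm ℂ B A).toLinearMap

/-! The operations of the quantum double `D(A, B)`, whose underlying vector space is `A ⊗ B`. -/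

/-- The multiplication of the quantum double,
`(a, b)(a', b') = ∑ (a a'₍₂₎, b₍₂₎ b') ⟨a'₍₁₎, S⁻¹ b₍₃₎⟩ ⟨a'₍₃₎, b₍₁₎⟩`. -/
noncomputable def doubleMul (P : HopfPairing A B) :
    (A ⊗[ℂ] B) →ₗ[ℂ] (A ⊗[ℂ] B) →ₗ[ℂ] (A ⊗[ℂ] B) :=
  TensorProduct.curry
    (TensorProduct.map (LinearMap.mul' ℂ A) (LinearMap.mul' ℂ B) ∘ₗ
      (TensorProduct.assoc ℂ A A (B ⊗[ℂ] B)).symm.toLinearMap ∘ₗ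
      ((TensorProduct.assoc ℂ A B B).toLinearMap ∘ₗ
        P.exchange.rTensor B ∘ₗ
        (TensorProduct.assoc ℂ B A B).symm.toLinearMap).lTensor A ∘ₗ
      (TensorProduct.assoc ℂ A B (A ⊗[ℂ] B)).toLinearMap)

/-- The involution of the quantum double,
`(a, b)^* = ∑ (a^*₍₂₎, b^*₍₂₎) ⟨a^*₍₃₎, b^*₍₁₎⟩ ⟨a^*₍₁₎, S⁻¹(b^*₍₃₎)⟩`, extended anti-linearly.
Note that `S⁻¹(b^*) = S(b)^*`. -/
noncomputable def doubleStar (P : HopfPairing A B) (x : A ⊗[ℂ] B) : A ⊗[ℂ] B :=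
  P.exchange (TensorProduct.comm ℂ A B (star x))

/-- The comultiplication of the quantum double,
`Δ(a, b) = ∑ (a₍₂₎, b₍₁₎) ⊗ (a₍₁₎, b₍₂₎)`. -/
noncomputable def doubleComul (_P : HopfPairing A B) :
    A ⊗[ℂ] B →ₗ[ℂ] (A ⊗[ℂ] B) ⊗[ℂ] (A ⊗[ℂ] B) :=
  (TensorProduct.tensorTensorTensorComm ℂ A A B B).toLinearMap ∘ₗ
    TensorProduct.map (comulOp A) comul

/-- The counit of the quantum double, `ε(a, b) = ε(a) ε(b)`. -/
noncomputable def doubleCounit (_P : HopfPairing A B) : A ⊗[ℂ] B →ₗ[ℂ] ℂ :=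
  LinearMap.mul' ℂ ℂ ∘ₗ TensorProduct.map counit counit

/-- The antipode of the quantum double, `S(a, b) = (1, S b)(S a, 1)`. -/
noncomputable def doubleAntipode (P : HopfPairing A B) : A ⊗[ℂ] B →ₗ[ℂ] A ⊗[ℂ] B :=
  P.exchange ∘ₗ TensorProduct.map (antipode ℂ) (antipode ℂ) ∘ₗ
    (TensorProduct.comm ℂ A B).toLinearMap

/-- The linear bijection `e` from `A ⊗ B` onto the finite Hopf C*-algebra `H` carries the
operations of the quantum double to those of `H`; that is, the quantum double with the C*-norm
transported from `H` is a finite Hopf C*-algebra. -/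
structure IsDoubleIso (P : HopfPairing A B) {H : Type*} [FiniteHopfCStarAlgebra H]
    (e : A ⊗[ℂ] B ≃ₗ[ℂ] H) : Prop where
  map_mul : ∀ x y, e (P.doubleMul x y) = e x * e y
  map_one : e (1 ⊗ₜ[ℂ] 1) = 1
  map_star : ∀ x, e (P.doubleStar x) = star (e x)
  map_comul : ∀ x,
    TensorProduct.map e.toLinearMap e.toLinearMap (P.doubleComul x) = comul (R := ℂ) (e x)
  map_counit : ∀ x, P.doubleCounit x = counit (R := ℂ) (e x)
  map_antipode : ∀ x, e (P.doubleAntipode x) = antipode ℂ (e x)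

end HopfPairing

/-- The functional `φ ⊗ ψ` on `A ⊗ B`, `(a, b) ↦ φ(a) ψ(b)`. -/
noncomputable def tensorFunctional {A : Type u} {B : Type v} [AddCommGroup A] [Module ℂ A]
    [AddCommGroup B] [Module ℂ B] (φ : A →ₗ[ℂ] ℂ) (ψ : B →ₗ[ℂ] ℂ) : A ⊗[ℂ] B →ₗ[ℂ] ℂ :=
  LinearMap.mul' ℂ ℂ ∘ₗ TensorProduct.map φ ψ

/-- `θ` is a faithful positive functional. -/
def IsFaithfulPositive {H : Type*} [CStarAlgebra H] (θ : H →ₗ[ℂ] ℂ) : Prop :=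
  (∀ x : H, 0 ≤ θ (star x * x)) ∧ ∀ x : H, θ (star x * x) = 0 → x = 0

/-- The GNS representation of a faithful positive functional `θ` on a finite dimensional
C*-algebra `H`, realised on the Hilbert space `K`: as a vector space `K` is a copy of `H`
through `toK`, the inner product of `x` and `y` is `θ(y^* x)` (Mathlib's `inner` is conjugate
linear in its first argument), and `π d` is the left multiplication by `d`. -/
structure GNSRepresentation {H : Type*} [CStarAlgebra H] (θ : H →ₗ[ℂ] ℂ) (K : Type*)
    [NormedAddCommGroup K] [InnerProductSpace ℂ K] [CompleteSpace K] where
  toK : H ≃ₗ[ℂ] K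
  π : H →⋆ₐ[ℂ] (K →L[ℂ] K)
  inner_toK : ∀ x y : H, inner ℂ (toK y) (toK x) = θ (star y * x)
  π_toK : ∀ d x : H, π d (toK x) = toK (d * x)

/-!
For a finite Hopf C*-algebra `A` the normalised trace `φ` of the left regular representation is a
faithful positive trace. Since `Δ(x)` acts on `A ⊗ A` as a conjugate of `x ⊗ 1`
(`regTrace_comul`), `φ` is idempotent for convolution, and a faithful idempotent state is
invariant (`rightSlice_haar_comul`): for `y = (ι ⊗ φ)Δ(a)` the element `Δ(y) - y ⊗ 1` has length
zero. Hence the invariant integral exists, and it is unique up to a scalar. Strong invariance,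
`∑ φ(c a₍₁₎) S(a₍₂₎) = ∑ φ(c₍₁₎ a) c₍₂₎`, and the trace property give `S² = 1`
(`antipode_antipode`).

The quantum double is realised by its regular representation on `A ⊗ B` (`HopfPairing.rep`).
There `A` acts by left multiplication on the first leg, and `B` acts through `Δ²` by three
commuting actions: the two actions of `B` on `A` defined by the pairing, and left multiplication
on `B`. These operators satisfy the exchange relation of the double (`repB_mul_repA`), the
representation is injective because `rep x (1 ⊗ 1) = x`, and its composition is the given product
(`doubleMul_eq`, `rep_doubleMul`), so that the product is associative. For the inner product
`(φ ⊗ ψ)(x^* y)` of the tensor product Hilbert space, strong invariance identifies the involution of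
the double with the adjoint (`isAdjoint_rep`). The double is thus a `*`-algebra of operators, and
carries a C*-norm. The element `1 ⊗ 1` is cyclic with vector functional `φ ⊗ ψ`, so this is the GNS
representation of `θ = φ ⊗ ψ`. As injective `*`-homomorphisms of C*-algebras are isometric, all
choices of `φ` and `ψ` give the same norm.

The comultiplication and the counit are multiplicative because they respect the commutation relation
`∑ ⟨a₍₁₎, b₍₂₎⟩ b₍₁₎ a₍₂₎ = ∑ ⟨a₍₂₎, b₍₁₎⟩ a₍₁₎ b₍₂₎` (`ExchangeRelation`), which determines
the product. Identities in Sweedler notation are checked on matrix coefficients, a spanning family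
with `Δ(t i j) = ∑ k, t i k ⊗ t k j`; they become identities between finite sums, since coassociativity
is built into the family.
-/

attribute [instance] FiniteHopfCStarAlgebra.finite_dim

/-! ### Reordering finite sums -/

theorem Finset.sum_univ_rev {α β γ M : Type*} [Fintype α] [Fintype β] [Fintype γ]
    [AddCommMonoid M] (f : α → β → γ → M) :
    ∑ a, ∑ b, ∑ c, f a b c = ∑ c, ∑ b, ∑ a, f a b c := by
  rw [Finset.sum_comm, Finset.sum_comm (γ := γ)]
  exact Finset.sum_congr rfl fun b _ => Finset.sum_comm

theorem Finset.sum_univ_pair_comm {α β γ δ M : Type*} [Fintype α] [Fintype β] [Fintype γ]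
    [Fintype δ] [AddCommMonoid M] (f : α → β → γ → δ → M) :
    ∑ a, ∑ b, ∑ c, ∑ d, f a b c d = ∑ c, ∑ d, ∑ a, ∑ b, f a b c d := by
  simp only [← Fintype.sum_prod_type']
  exact Fintype.sum_equiv
    { toFun := fun (a, b, c, d) => (c, d, a, b)
      invFun := fun (c, d, a, b) => (a, b, c, d) } _ _ fun _ => rfl

theorem Finset.sum_univ_reorder_four {α β γ δ M : Type*} [Fintype α] [Fintype β] [Fintype γ]
    [Fintype δ] [AddCommMonoid M] (f : α → β → γ → δ → M) :
    ∑ a, ∑ b, ∑ c, ∑ d, f a b c d = ∑ b, ∑ d, ∑ a, ∑ c, f a b c d := by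
  simp only [← Fintype.sum_prod_type']
  exact Fintype.sum_equiv
    { toFun := fun (a, b, c, d) => (b, d, a, c)
      invFun := fun (b, d, a, c) => (a, b, c, d) } _ _ fun _ => rfl

theorem Finset.sum_univ_reorder_six {α β γ δ ε ζ M : Type*} [Fintype α] [Fintype β] [Fintype γ]
    [Fintype δ] [Fintype ε] [Fintype ζ] [AddCommMonoid M] (f : α → β → γ → δ → ε → ζ → M) :
    ∑ a, ∑ b, ∑ c, ∑ d, ∑ e, ∑ g, f a b c d e g =
      ∑ g, ∑ d, ∑ e, ∑ c, ∑ a, ∑ b, f a b c d e g := by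
  simp only [← Fintype.sum_prod_type']
  exact Fintype.sum_equiv
    { toFun := fun (a, b, c, d, e, g) => (g, d, e, c, a, b)
      invFun := fun (g, d, e, c, a, b) => (a, b, c, d, e, g) } _ _ fun _ => rfl

theorem Finset.sum_univ_reorder {α β γ δ ε ζ M : Type*} [Fintype α] [Fintype β] [Fintype γ]
    [Fintype δ] [Fintype ε] [Fintype ζ] [AddCommMonoid M] (f : α → β → γ → δ → ε → ζ → M) :
    ∑ a, ∑ b, ∑ c, ∑ d, ∑ e, ∑ g, f a b c d e g =
      ∑ c, ∑ e, ∑ d, ∑ g, ∑ a, ∑ b, f a b c d e g := by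
  simp only [← Fintype.sum_prod_type']
  exact Fintype.sum_equiv
    { toFun := fun (a, b, c, d, e, g) => (c, e, d, g, a, b)
      invFun := fun (c, e, d, g, a, b) => (a, b, c, d, e, g) } _ _ fun _ => rfl

/-! ### Matrix coefficients of a finite dimensional coalgebra -/

theorem Module.Basis.sum_tmul_injective {ι M V : Type*} [Fintype ι] [AddCommGroup V] [Module ℂ V]
    [AddCommGroup M] [Module ℂ M] (b : Module.Basis ι ℂ V) {x y : ι → M}
    (h : ∑ i, b i ⊗ₜ[ℂ] x i = ∑ i, b i ⊗ₜ[ℂ] y i) : x = y := by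
  classical
  funext k
  have := congrArg (fun z => TensorProduct.lid ℂ M ((b.coord k).rTensor M z)) h
  simpa [Finsupp.single_apply, ite_smul] using this

section MatrixCoefficients

variable {C : Type u} [AddCommGroup C] [Module ℂ C] [Coalgebra ℂ C] [FiniteDimensional ℂ C]

variable (C) in
/-- The matrix coefficients of `C` as a right comodule over itself, in a fixed basis `e`:
`Δ(e j) = ∑ i, e i ⊗ matCoeff C i j`. -/
noncomputable def matCoeff (i j : Fin (Module.finrank ℂ C)) : C :=
  TensorProduct.lid ℂ C (((Module.finBasis ℂ C).coord i).rTensor C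
    (comul (R := ℂ) (Module.finBasis ℂ C j)))

theorem comul_finBasis (j : Fin (Module.finrank ℂ C)) :
    comul (R := ℂ) (Module.finBasis ℂ C j) =
      ∑ i, Module.finBasis ℂ C i ⊗ₜ[ℂ] matCoeff C i j := by
  unfold matCoeff
  generalize comul (R := ℂ) (Module.finBasis ℂ C j) = z
  induction z with
  | zero => simp
  | add x y hx hy => simp [TensorProduct.tmul_add, Finset.sum_add_distrib, ← hx, ← hy]
  | tmul x y =>
    simp only [LinearMap.rTensor_tmul, TensorProduct.lid_tmul, ← TensorProduct.smul_tmul,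
      ← TensorProduct.sum_tmul]
    congr 1
    exact ((Module.finBasis ℂ C).sum_repr x).symm

@[simp]
theorem comul_matCoeff (i j : Fin (Module.finrank ℂ C)) :
    comul (R := ℂ) (matCoeff C i j) = ∑ k, matCoeff C i k ⊗ₜ[ℂ] matCoeff C k j := by
  have h := coassoc_apply (R := ℂ) (Module.finBasis ℂ C j)
  simp only [comul_finBasis, map_sum, LinearMap.rTensor_tmul, LinearMap.lTensor_tmul,
    TensorProduct.sum_tmul, TensorProduct.assoc_tmul] at h
  rw [Finset.sum_comm] at h
  simp only [← TensorProduct.tmul_sum] at h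
  exact (congrFun ((Module.finBasis ℂ C).sum_tmul_injective h) i).symm

@[simp]
theorem counit_matCoeff (i j : Fin (Module.finrank ℂ C)) :
    counit (R := ℂ) (matCoeff C i j) = if i = j then 1 else 0 := by
  have h := congrArg (TensorProduct.rid ℂ C)
    (lTensor_counit_comul (R := ℂ) (Module.finBasis ℂ C j))
  simp only [comul_finBasis, map_sum, LinearMap.lTensor_tmul, TensorProduct.rid_tmul,
    one_smul] at h
  have h2 := congrArg (fun z => (Module.finBasis ℂ C).coord i z) h
  simpa [Finsupp.single_apply, eq_comm] using h2

/-- The matrix coefficients span `C`, so that linear maps are determined by their values there. -/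
theorem LinearMap.ext_matCoeff {M : Type*} [AddCommMonoid M] [Module ℂ M] {f g : C →ₗ[ℂ] M}
    (h : ∀ i j, f (matCoeff C i j) = g (matCoeff C i j)) : f = g := by
  refine (Module.finBasis ℂ C).ext fun j => ?_
  have hj := congrArg (TensorProduct.lid ℂ C)
    (rTensor_counit_comul (R := ℂ) (Module.finBasis ℂ C j))
  simp only [comul_finBasis, map_sum, LinearMap.rTensor_tmul, TensorProduct.lid_tmul,
    one_smul] at hj
  simp [← hj, h]

end MatrixCoefficients

section Antipode

variable {A : Type u} [FiniteHopfCStarAlgebra A]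

theorem sum_antipode_mul_matCoeff (i j : Fin (Module.finrank ℂ A)) :
    ∑ k, antipode ℂ (matCoeff A i k) * matCoeff A k j = if i = j then 1 else 0 := by
  have h := mul_antipode_rTensor_comul_apply (R := ℂ) (matCoeff A i j)
  simpa [apply_ite] using h

theorem sum_mul_antipode_matCoeff (i j : Fin (Module.finrank ℂ A)) :
    ∑ k, matCoeff A i k * antipode ℂ (matCoeff A k j) = if i = j then 1 else 0 := by
  have h := mul_antipode_lTensor_comul_apply (R := ℂ) (matCoeff A i j)
  simpa [apply_ite] using h

end Antipode

/-! ### The trace of the regular representation of a C*-algebra -/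

section RegularTrace

variable {A : Type u} [CStarAlgebra A]

/-- The trace of left multiplication by `x`. -/
noncomputable def regTrace (A : Type u) [CStarAlgebra A] : A →ₗ[ℂ] ℂ :=
  LinearMap.trace ℂ A ∘ₗ (Algebra.lmul ℂ A).toLinearMap

theorem regTrace_apply (x : A) : regTrace A x = LinearMap.trace ℂ A (Algebra.lmul ℂ A x) := rfl

theorem regTrace_mul_comm (x y : A) : regTrace A (x * y) = regTrace A (y * x) := by
  rw [regTrace_apply, regTrace_apply, map_mul (Algebra.lmul ℂ A), map_mul (Algebra.lmul ℂ A),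
    LinearMap.trace_mul_comm]

theorem regTrace_one [FiniteDimensional ℂ A] : regTrace A 1 = Module.finrank ℂ A := by
  rw [regTrace_apply, map_one, LinearMap.trace_one]

theorem spectrum_lmul (x : A) : spectrum ℂ (Algebra.lmul ℂ A x) = spectrum ℂ x := by
  refine Set.Subset.antisymm (AlgHom.spectrum_apply_subset _ x) fun μ hμ hu => hμ ?_
  rw [spectrum.mem_resolventSet_iff, ← AlgHom.commutes (Algebra.lmul ℂ A) μ, ← map_sub,
    Module.End.isUnit_iff] at hu
  obtain ⟨w, hw⟩ := hu.2 1
  replace hw : (algebraMap ℂ A μ - x) * w = 1 := hw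
  have hw' : w * (algebraMap ℂ A μ - x) = 1 := hu.1 ?_
  · exact ⟨⟨_, w, hw, hw'⟩, rfl⟩
  change (algebraMap ℂ A μ - x) * (w * (algebraMap ℂ A μ - x)) = (algebraMap ℂ A μ - x) * 1
  rw [← mul_assoc, hw, one_mul, mul_one]

variable [FiniteDimensional ℂ A]

theorem nonneg_of_mem_roots_charpoly_lmul (x : A) {μ : ℂ}
    (hμ : μ ∈ (Algebra.lmul ℂ A (star x * x)).charpoly.roots) : 0 ≤ μ := by
  have h := Polynomial.isRoot_of_mem_roots hμ
  rw [← Module.End.mem_spectrum_iff_isRoot_charpoly, spectrum_lmul] at h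
  have hs := (IsSelfAdjoint.star_mul_self x).mem_spectrum_eq_re h
  rw [hs] at h ⊢
  rw [← Complex.coe_algebraMap, spectrum.algebraMap_mem_iff] at h
  exact_mod_cast spectrum_star_mul_self_nonneg _ h

theorem regTrace_eq_sum_roots (x : A) :
    regTrace A x = (Algebra.lmul ℂ A x).charpoly.roots.sum :=
  Module.End.trace_eq_sum_roots_charpoly_of_splits (IsAlgClosed.splits _)

theorem regTrace_star_mul_self_nonneg (x : A) : 0 ≤ regTrace A (star x * x) := by
  rw [regTrace_eq_sum_roots]
  exact Multiset.sum_nonneg fun μ => nonneg_of_mem_roots_charpoly_lmul x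

theorem eq_zero_of_regTrace_star_mul_self (x : A) (h : regTrace A (star x * x) = 0) : x = 0 := by
  rw [regTrace_eq_sum_roots] at h
  have h0 : ∀ μ ∈ (Algebra.lmul ℂ A (star x * x)).charpoly.roots, μ = 0 := fun μ hμ =>
    le_antisymm (h ▸ Multiset.single_le_sum (fun ν => nonneg_of_mem_roots_charpoly_lmul x) μ hμ)
      (nonneg_of_mem_roots_charpoly_lmul x hμ)
  have hr : spectralRadius ℂ (star x * x) = 0 := by
    simp only [spectralRadius, ENNReal.iSup_eq_zero, ENNReal.coe_eq_zero, nnnorm_eq_zero]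
    intro μ hμ
    rw [← spectrum_lmul, Module.End.mem_spectrum_iff_isRoot_charpoly] at hμ
    exact h0 μ ((Polynomial.mem_roots (LinearMap.charpoly_monic _).ne_zero).2 hμ)
  rw [(IsSelfAdjoint.star_mul_self x).spectralRadius_eq_nnnorm] at hr
  simpa using hr

end RegularTrace

/-! ### The inner product space of a faithful positive functional -/

section PosDef

/-- `θ` is a faithful positive functional on the `*`-algebra `V`; for C*-algebras this is
`IsFaithfulPositive`. -/
def PosDef {V : Type*} [Ring V] [StarRing V] [Algebra ℂ V] (θ : V →ₗ[ℂ] ℂ) : Prop :=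
  (∀ x : V, 0 ≤ θ (star x * x)) ∧ ∀ x : V, θ (star x * x) = 0 → x = 0

variable {V : Type*} [Ring V] [StarRing V] [Algebra ℂ V] [StarModule ℂ V] {θ : V →ₗ[ℂ] ℂ}

theorem PosDef.star_apply (h : PosDef θ) (x y : V) :
    star (θ (star y * x)) = θ (star x * y) := by
  have real : ∀ z : V, (θ (star z * z)).im = 0 := fun z => (Complex.nonneg_iff.1 (h.1 z)).2.symm
  have hx := real x
  have hy := real y
  have h1 := real (x + y)
  have h2 := real (x + Complex.I • y)
  simp only [star_add, star_smul, mul_add, add_mul, map_add, smul_mul_assoc, mul_smul_comm,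
    map_smul, smul_eq_mul, Complex.add_im, Complex.mul_im, Complex.mul_re, Complex.I_re,
    Complex.I_im, RCLike.star_def, Complex.conj_I, Complex.neg_re, Complex.neg_im] at h1 h2
  apply Complex.ext <;> simp <;> linarith

/-- The inner product `⟨x, y⟩ = θ(x^* y)`. -/
@[reducible]
noncomputable def PosDef.core (h : PosDef θ) : InnerProductSpace.Core ℂ V where
  inner x y := θ (star x * y)
  conj_inner_symm x y := h.star_apply x y
  re_inner_nonneg x := (Complex.nonneg_iff.1 (h.1 x)).1
  add_left x y z := by simp [add_mul]
  smul_left x y r := by simp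
  definite x := h.2 x

/-- A copy of `V` that carries the inner product of `θ`, rather than a given norm of `V`. -/
def GNSSpace {V : Type*} [Ring V] [StarRing V] [Algebra ℂ V] {θ : V →ₗ[ℂ] ℂ} (_ : PosDef θ) :
    Type _ := V

namespace GNSSpace

variable (h : PosDef θ)

noncomputable instance : NormedAddCommGroup (GNSSpace h) :=
  @InnerProductSpace.Core.toNormedAddCommGroup ℂ V _ _ _ h.core

noncomputable instance : InnerProductSpace ℂ (GNSSpace h) :=
  @InnerProductSpace.ofCore ℂ V _ _ _ h.core.toCore

/-- The identity map of `V`. -/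
noncomputable def equiv : V ≃ₗ[ℂ] GNSSpace h := LinearEquiv.refl ℂ V

instance [FiniteDimensional ℂ V] : FiniteDimensional ℂ (GNSSpace h) :=
  (equiv h).finiteDimensional

theorem clm_ext {S T : GNSSpace h →L[ℂ] GNSSpace h}
    (hST : ∀ x, S (equiv h x) = T (equiv h x)) : S = T := by
  ext x
  obtain ⟨x, rfl⟩ := (equiv h).surjective x
  exact hST x

end GNSSpace

end PosDef

@[simp]
theorem tensorFunctional_tmul {A : Type u} {B : Type v} [AddCommGroup A] [Module ℂ A]
    [AddCommGroup B] [Module ℂ B] (φ : A →ₗ[ℂ] ℂ) (ψ : B →ₗ[ℂ] ℂ) (a : A) (b : B) :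
    tensorFunctional φ ψ (a ⊗ₜ b) = φ a * ψ b := by
  simp [tensorFunctional]

/-- The inner product of `φ ⊗ ψ` is that of the tensor product of two Hilbert spaces. -/
theorem PosDef.tensorFunctional {A : Type u} {B : Type v} [Ring A] [StarRing A] [Algebra ℂ A]
    [StarModule ℂ A] [Ring B] [StarRing B] [Algebra ℂ B] [StarModule ℂ B] {φ : A →ₗ[ℂ] ℂ}
    {ψ : B →ₗ[ℂ] ℂ} (hφ : PosDef φ) (hψ : PosDef ψ) : PosDef (tensorFunctional φ ψ) := by
  let E := TensorProduct.congr (GNSSpace.equiv hφ) (GNSSpace.equiv hψ)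
  have key : ∀ x y, _root_.tensorFunctional φ ψ (star x * y) = inner ℂ (E x) (E y) := by
    intro x y
    induction x with
    | zero => simp
    | add x x' hx hx' => simp [add_mul, inner_add_left, hx, hx']
    | tmul a b =>
      induction y with
      | zero => simp
      | add x x' hx hx' => rw [mul_add, map_add, map_add, inner_add_right, hx, hx']
      | tmul a' b' =>
        simp only [E, TensorProduct.star_tmul, Algebra.TensorProduct.tmul_mul_tmul,
          tensorFunctional_tmul, TensorProduct.congr_tmul, TensorProduct.inner_tmul]
        rfl
  refine ⟨fun x => ?_, fun x hx => ?_⟩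
  · have h : 0 ≤ ((‖E x‖ : ℂ)) ^ 2 := by exact_mod_cast sq_nonneg ‖E x‖
    exact h.trans_eq ((inner_self_eq_norm_sq_to_K (𝕜 := ℂ) (E x)).symm.trans (key x x).symm)
  · exact E.map_eq_zero_iff.1 (inner_self_eq_zero (𝕜 := ℂ).1 ((key x x).symm.trans hx))

/-! ### The invariant integral -/

section Haar

variable {A : Type u} [FiniteHopfCStarAlgebra A]

theorem tensorFunctional_regTrace (z : A ⊗[ℂ] A) :
    tensorFunctional (regTrace A) (regTrace A) z =
      LinearMap.trace ℂ (A ⊗[ℂ] A) (Algebra.lmul ℂ (A ⊗[ℂ] A) z) := by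
  induction z with
  | zero => simp
  | add x y hx hy => simp only [map_add, hx, hy]
  | tmul x y =>
    rw [tensorFunctional_tmul, regTrace_apply, regTrace_apply, ← LinearMap.trace_tensorProduct']
    congr 1
    ext a b
    simp

/-- The map `a ⊗ b ↦ ∑ a₍₁₎ ⊗ f(a₍₂₎) b`. -/
noncomputable def galoisMap (f : A →ₗ[ℂ] A) : A ⊗[ℂ] A →ₗ[ℂ] A ⊗[ℂ] A :=
  (LinearMap.mul' ℂ A ∘ₗ f.rTensor A).lTensor A ∘ₗ
    (TensorProduct.assoc ℂ A A A).toLinearMap ∘ₗ comul.rTensor A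

theorem galoisMap_matCoeff (f : A →ₗ[ℂ] A) (i j : Fin (Module.finrank ℂ A)) (b : A) :
    galoisMap f (matCoeff A i j ⊗ₜ b) =
      ∑ k, matCoeff A i k ⊗ₜ[ℂ] (f (matCoeff A k j) * b) := by
  simp [galoisMap, TensorProduct.sum_tmul]

/-- The bijection `a ⊗ b ↦ Δ(a)(1 ⊗ b)`. -/
noncomputable def galoisEquiv (A : Type u) [FiniteHopfCStarAlgebra A] :
    A ⊗[ℂ] A ≃ₗ[ℂ] A ⊗[ℂ] A :=
  LinearEquiv.ofLinearMap (galoisMap LinearMap.id) (galoisMap (antipode ℂ))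
    (by
      refine TensorProduct.ext (LinearMap.ext_matCoeff fun i j => LinearMap.ext fun b => ?_)
      change galoisMap _ (galoisMap _ (matCoeff A i j ⊗ₜ b)) = matCoeff A i j ⊗ₜ b
      simp only [galoisMap_matCoeff, map_sum, LinearMap.id_apply]
      rw [Finset.sum_comm]
      simp only [← TensorProduct.tmul_sum, ← mul_assoc, ← Finset.sum_mul,
        sum_mul_antipode_matCoeff]
      simp [ite_mul, TensorProduct.tmul_ite])
    (by
      refine TensorProduct.ext (LinearMap.ext_matCoeff fun i j => LinearMap.ext fun b => ?_)
      change galoisMap _ (galoisMap _ (matCoeff A i j ⊗ₜ b)) = matCoeff A i j ⊗ₜ b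
      simp only [galoisMap_matCoeff, map_sum, LinearMap.id_apply]
      rw [Finset.sum_comm]
      simp only [← TensorProduct.tmul_sum, ← mul_assoc, ← Finset.sum_mul,
        sum_antipode_mul_matCoeff]
      simp [ite_mul, TensorProduct.tmul_ite])

theorem galoisEquiv_tmul (a b : A) : galoisEquiv A (a ⊗ₜ b) = comul (R := ℂ) a * (1 ⊗ₜ b) := by
  have : (galoisMap (LinearMap.id) ∘ₗ (TensorProduct.mk ℂ A A).flip b) =
      LinearMap.mulRight ℂ ((1 : A) ⊗ₜ[ℂ] b) ∘ₗ comul :=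
    LinearMap.ext_matCoeff fun i j => by simp [galoisMap_matCoeff]
  exact LinearMap.congr_fun this a

/-- `Δ(x)` acts on `A ⊗ A` as a conjugate of `x ⊗ 1`, so that the regular character is, up to a
scalar, an idempotent for the convolution product. -/
theorem regTrace_comul (x : A) :
    tensorFunctional (regTrace A) (regTrace A) (comul x) =
      Module.finrank ℂ A * regTrace A x := by
  have h : Algebra.lmul ℂ (A ⊗[ℂ] A) (comul x) =
      (galoisEquiv A).conj (TensorProduct.map (Algebra.lmul ℂ A x) LinearMap.id) := by
    rw [LinearEquiv.conj_apply, LinearEquiv.eq_comp_toLinearMap_symm]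
    ext a b
    simp [galoisEquiv_tmul, mul_assoc]
  rw [tensorFunctional_regTrace, h, LinearMap.trace_conj', LinearMap.trace_tensorProduct',
    LinearMap.trace_id, regTrace_apply, mul_comm]

instance : Nontrivial A := by
  refine ⟨0, 1, fun h => ?_⟩
  have h2 := congrArg (counit (R := ℂ)) h
  simp at h2

/-- The normalised regular character. -/
noncomputable def haar (A : Type u) [FiniteHopfCStarAlgebra A] : A →ₗ[ℂ] ℂ :=
  (Module.finrank ℂ A : ℂ)⁻¹ • regTrace A

theorem finrank_cast_ne_zero : (Module.finrank ℂ A : ℂ) ≠ 0 :=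
  Nat.cast_ne_zero.2 Module.finrank_pos.ne'

theorem haar_one : haar A 1 = 1 := by
  rw [haar, LinearMap.smul_apply, regTrace_one, smul_eq_mul,
    inv_mul_cancel₀ (finrank_cast_ne_zero (A := A))]

theorem haar_mul_comm (x y : A) : haar A (x * y) = haar A (y * x) := by
  simp [haar, regTrace_mul_comm x y]

theorem haar_posDef : PosDef (haar A) := by
  refine ⟨fun x => ?_, fun x hx => eq_zero_of_regTrace_star_mul_self x ?_⟩
  · refine mul_nonneg ?_ (regTrace_star_mul_self_nonneg x)
    rw [← Complex.ofReal_natCast, ← Complex.ofReal_inv]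
    exact Complex.zero_le_real.2 (by positivity)
  · exact (mul_eq_zero.1 hx).resolve_left (inv_ne_zero finrank_cast_ne_zero)

theorem tensorFunctional_haar_comul (x : A) :
    tensorFunctional (haar A) (haar A) (comul x) = haar A x := by
  have : tensorFunctional (haar A) (haar A) = ((Module.finrank ℂ A : ℂ)⁻¹ ^ 2) •
      tensorFunctional (regTrace A) (regTrace A) := by
    ext; simp [haar]; ring
  rw [this, LinearMap.smul_apply, regTrace_comul, haar, LinearMap.smul_apply, smul_eq_mul,
    smul_eq_mul]
  field_simp [finrank_cast_ne_zero (A := A)]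

/-- The slice map `ι ⊗ φ`. -/
noncomputable def rightSlice (φ : A →ₗ[ℂ] ℂ) : A ⊗[ℂ] A →ₗ[ℂ] A :=
  (TensorProduct.rid ℂ A).toLinearMap ∘ₗ φ.lTensor A

@[simp]
theorem rightSlice_tmul (φ : A →ₗ[ℂ] ℂ) (a b : A) : rightSlice φ (a ⊗ₜ b) = φ b • a := by
  simp [rightSlice]

theorem rightSlice_comul_rightSlice_comul (a : A) :
    rightSlice (haar A) (comul (rightSlice (haar A) (comul (R := ℂ) a))) =
      rightSlice (haar A) (comul (R := ℂ) a) := by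
  have : rightSlice (haar A) ∘ₗ comul ∘ₗ rightSlice (haar A) ∘ₗ comul (R := ℂ) =
      rightSlice (haar A) ∘ₗ comul := by
    refine LinearMap.ext_matCoeff fun i j => ?_
    simp only [LinearMap.comp_apply, comul_matCoeff, map_sum, rightSlice_tmul, map_smul,
      Finset.smul_sum, smul_smul]
    rw [Finset.sum_comm]
    refine Finset.sum_congr rfl fun k _ => ?_
    rw [← Finset.sum_smul, ← tensorFunctional_haar_comul, comul_matCoeff]
    simp [mul_comm]
  exact LinearMap.congr_fun this a

/-- Right invariance of a faithful idempotent state `ψ`: if `y = (ι ⊗ ψ)Δ(a)`, then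
`Δ(y) - y ⊗ 1` has length zero for the inner product of `ψ ⊗ ψ`, whence `Δ(y) = y ⊗ 1`. -/
theorem rightSlice_haar_comul (a : A) :
    rightSlice (haar A) (comul (R := ℂ) a) = haar A a • (1 : A) := by
  set y := rightSlice (haar A) (comul (R := ℂ) a) with hy
  have hyy : rightSlice (haar A) (comul (R := ℂ) y) = y := rightSlice_comul_rightSlice_comul a
  have hpos : PosDef (tensorFunctional (haar A) (haar A)) :=
    haar_posDef.tensorFunctional haar_posDef
  have slice : ∀ (c : A) (z : A ⊗[ℂ] A), tensorFunctional (haar A) (haar A) ((c ⊗ₜ 1) * z) =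
      haar A (c * rightSlice (haar A) z) := by
    intro c z
    induction z with
    | zero => simp
    | add x y hx hy => simp only [mul_add, map_add, hx, hy]
    | tmul x y => simp [mul_comm]
  have h1 : tensorFunctional (haar A) (haar A) (star (y ⊗ₜ[ℂ] 1) * comul y) =
      haar A (star y * y) := by
    rw [TensorProduct.star_tmul, star_one, slice, hyy]
  have h2 : tensorFunctional (haar A) (haar A) (star (comul y) * (y ⊗ₜ[ℂ] 1)) =
      haar A (star y * y) := by
    rw [← hpos.star_apply, h1, haar_posDef.star_apply]
  have h3 : tensorFunctional (haar A) (haar A) (star (comul y) * comul y) =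
      haar A (star y * y) := by
    rw [← FiniteHopfCStarAlgebra.comul_star, ← Bialgebra.comul_mul, tensorFunctional_haar_comul]
  have h4 : tensorFunctional (haar A) (haar A) (star (y ⊗ₜ[ℂ] 1) * (y ⊗ₜ[ℂ] 1)) =
      haar A (star y * y) := by
    simp [haar_one]
  have h5 : comul (R := ℂ) y = y ⊗ₜ 1 := by
    refine sub_eq_zero.1 (hpos.2 _ ?_)
    rw [star_sub, sub_mul, mul_sub, mul_sub, map_sub, map_sub, map_sub, h1, h2, h3, h4]
    ring
  have h6 := congrArg (TensorProduct.lid ℂ A) (rTensor_counit_comul (R := ℂ) y)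
  rw [h5] at h6
  have h7 : counit (R := ℂ) y = haar A a := by
    have : (counit (R := ℂ)) ∘ₗ rightSlice (haar A) ∘ₗ comul = haar A :=
      LinearMap.ext_matCoeff fun i j => by simp
    exact LinearMap.congr_fun this a
  simpa [h7] using h6.symm

end Haar

/-! ### Two-sided invariance, strong invariance and the square of the antipode -/

section HaarInvariance

variable {A : Type u} [FiniteHopfCStarAlgebra A]

/-- The antipode is anticomultiplicative. -/
theorem comul_antipode_matCoeff (i j : Fin (Module.finrank ℂ A)) :
    comul (R := ℂ) (antipode ℂ (matCoeff A i j)) =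
      ∑ k, antipode ℂ (matCoeff A k j) ⊗ₜ[ℂ] antipode ℂ (matCoeff A i k) := by
  -- `X` is a left inverse and `Z` a right inverse of the matrix `Y` over `A ⊗ A`
  let X : Matrix (Fin (Module.finrank ℂ A)) (Fin (Module.finrank ℂ A)) (A ⊗[ℂ] A) :=
    Matrix.of fun i j => comul (R := ℂ) (antipode ℂ (matCoeff A i j))
  let Y : Matrix (Fin (Module.finrank ℂ A)) (Fin (Module.finrank ℂ A)) (A ⊗[ℂ] A) :=
    Matrix.of fun i j => comul (R := ℂ) (matCoeff A i j)
  let Z : Matrix (Fin (Module.finrank ℂ A)) (Fin (Module.finrank ℂ A)) (A ⊗[ℂ] A) :=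
    Matrix.of fun i j => ∑ k, antipode ℂ (matCoeff A k j) ⊗ₜ[ℂ] antipode ℂ (matCoeff A i k)
  have hXY : X * Y = 1 := by
    ext i j
    simp only [X, Y, Matrix.mul_apply, Matrix.of_apply, ← Bialgebra.comul_mul, ← map_sum,
      sum_antipode_mul_matCoeff, Matrix.one_apply]
    split_ifs <;> simp
  have hYZ : Y * Z = 1 := by
    ext i j
    simp only [Y, Z, Matrix.mul_apply, Matrix.of_apply, comul_matCoeff, Finset.sum_mul_sum,
      Algebra.TensorProduct.tmul_mul_tmul]
    rw [Finset.sum_comm]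
    have : ∀ m, ∑ l, ∑ k, (matCoeff A i m * antipode ℂ (matCoeff A k j)) ⊗ₜ[ℂ]
        (matCoeff A m l * antipode ℂ (matCoeff A l k)) =
        (matCoeff A i m * antipode ℂ (matCoeff A m j)) ⊗ₜ[ℂ] 1 := by
      intro m
      rw [Finset.sum_comm]
      simp only [← TensorProduct.tmul_sum, sum_mul_antipode_matCoeff, TensorProduct.tmul_ite]
      simp
    simp only [this, ← TensorProduct.sum_tmul, sum_mul_antipode_matCoeff, Matrix.one_apply]
    split_ifs <;> simp [Algebra.TensorProduct.one_def]
  exact congrArg (fun M => M i j) (left_inv_eq_right_inv hXY hYZ)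

theorem sum_haar_smul_right (i j : Fin (Module.finrank ℂ A)) :
    ∑ k, haar A (matCoeff A k j) • matCoeff A i k = haar A (matCoeff A i j) • (1 : A) := by
  rw [← rightSlice_haar_comul]
  simp

theorem sum_haar_antipode_smul_left (i j : Fin (Module.finrank ℂ A)) :
    ∑ k, haar A (antipode ℂ (matCoeff A i k)) • matCoeff A k j =
      haar A (antipode ℂ (matCoeff A i j)) • (1 : A) := by
  apply (antipodeEquiv A).injective
  change antipode ℂ _ = antipode ℂ _
  have h := rightSlice_haar_comul (antipode ℂ (matCoeff A i j))
  rw [comul_antipode_matCoeff] at h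
  simpa using h

/-- `φ ∘ S` is left invariant and `φ` is right invariant, so evaluating `(φ ∘ S) ⊗ φ` on `Δ(a)` in
both ways shows that they agree. -/
theorem haar_antipode (a : A) : haar A (antipode ℂ a) = haar A a := by
  have : haar A ∘ₗ antipode ℂ = haar A := by
    refine LinearMap.ext_matCoeff fun i j => ?_
    have h1 := congrArg (haar A) (sum_haar_antipode_smul_left i j)
    have h2 := congrArg (haar A ∘ₗ antipode ℂ) (sum_haar_smul_right i j)
    simp only [map_sum, map_smul, smul_eq_mul, haar_one, mul_one, LinearMap.comp_apply,
      antipode_one] at h1 h2 ⊢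
    rw [← h1, ← h2]
    exact Finset.sum_congr rfl fun k _ => mul_comm _ _
  exact LinearMap.congr_fun this a

theorem haar_isInvariantIntegral : IsInvariantIntegral (haar A) where
  left_inv a := by
    have : (TensorProduct.lid ℂ A).toLinearMap ∘ₗ (haar A).rTensor A ∘ₗ comul =
        (LinearMap.toSpanSingleton ℂ A 1) ∘ₗ haar A := by
      refine LinearMap.ext_matCoeff fun i j => ?_
      have := sum_haar_antipode_smul_left i j
      simp only [haar_antipode] at this
      simpa using this
    exact LinearMap.congr_fun this a
  right_inv a := rightSlice_haar_comul a
  antipode_inv := haar_antipode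
  one_pos := by simp [haar_one]

/-- Uniqueness of the invariant functional up to a scalar. -/
theorem IsInvariantFunctional.eq_smul_haar {φ : A →ₗ[ℂ] ℂ} (hφ : IsInvariantFunctional φ) :
    φ = φ 1 • haar A := by
  ext a
  have h1 := congrArg (haar A) (hφ.left_inv a)
  have h2 := congrArg φ (rightSlice_haar_comul a)
  have h3 : ∀ z : A ⊗[ℂ] A, haar A (TensorProduct.lid ℂ A (φ.rTensor A z)) =
      φ (rightSlice (haar A) z) := by
    intro z
    induction z with
    | zero => simp
    | add x y hx hy => simp only [map_add, hx, hy]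
    | tmul x y => simp [mul_comm]
  rw [h3, h2] at h1
  simpa [haar_one, mul_comm] using h1.symm

theorem IsInvariantIntegral.posDef {φ : A →ₗ[ℂ] ℂ} (hφ : IsInvariantIntegral φ) : PosDef φ := by
  rw [hφ.toIsInvariantFunctional.eq_smul_haar]
  exact ⟨fun x => mul_nonneg hφ.one_pos.le (haar_posDef.1 x), fun x hx =>
    haar_posDef.2 x ((mul_eq_zero.1 hx).resolve_left hφ.one_pos.ne')⟩

namespace IsInvariantFunctional

variable {φ : A →ₗ[ℂ] ℂ} (hφ : IsInvariantFunctional φ)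
include hφ

/-- Strong left invariance, `∑ φ(c a₍₁₎) S(a₍₂₎) = ∑ φ(c₍₁₎ a) c₍₂₎`. -/
theorem sum_mul_smul_antipode (i j k l : Fin (Module.finrank ℂ A)) :
    ∑ m, φ (matCoeff A i j * matCoeff A k m) • antipode ℂ (matCoeff A m l) =
      ∑ n, φ (matCoeff A i n * matCoeff A k l) • matCoeff A n j := by
  have h : ∀ p, ∑ m, ∑ n, φ (matCoeff A i n * matCoeff A k m) •
      (matCoeff A n j * matCoeff A m p) = φ (matCoeff A i j * matCoeff A k p) • (1 : A) := by
    intro p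
    have := hφ.left_inv (matCoeff A i j * matCoeff A k p)
    rw [Bialgebra.comul_mul] at this
    rw [← this, Finset.sum_comm]
    simp [Finset.sum_mul_sum]
  calc _ = ∑ p, ∑ m, ∑ n, φ (matCoeff A i n * matCoeff A k m) •
      (matCoeff A n j * (matCoeff A m p * antipode ℂ (matCoeff A p l))) := by
        refine Finset.sum_congr rfl fun p _ => ?_
        rw [← one_mul (antipode ℂ _), ← smul_mul_assoc, ← h]
        simp only [Finset.sum_mul, smul_mul_assoc, mul_assoc, one_mul]
    _ = ∑ n, ∑ m, φ (matCoeff A i n * matCoeff A k m) •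
      (matCoeff A n j * ∑ p, (matCoeff A m p * antipode ℂ (matCoeff A p l))) := by
        simp only [Finset.mul_sum, Finset.smul_sum]
        exact Finset.sum_univ_rev _
    _ = _ := by
        simp [sum_mul_antipode_matCoeff]

end IsInvariantFunctional

/-- The square of the antipode is the identity, as the invariant integral is a faithful trace. -/
theorem antipode_antipode (a : A) : antipode ℂ (antipode ℂ a) = a := by
  have h : antipode ℂ ∘ₗ antipode ℂ = (LinearMap.id : A →ₗ[ℂ] A) := by
    refine LinearMap.ext_matCoeff fun k l => ?_
    -- `∑ φ(c a₍₁₎) S(S(a₍₂₎)) = ∑ φ(c a₍₁₎) a₍₂₎`, by applying strong invariance twice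
    have h1 : ∀ i j, ∑ m, haar A (matCoeff A i j * matCoeff A k m) •
        (antipode ℂ (antipode ℂ (matCoeff A m l)) - matCoeff A m l) = 0 := by
      intro i j
      have e1 := congrArg (antipode ℂ)
        (haar_isInvariantIntegral.toIsInvariantFunctional.sum_mul_smul_antipode i j k l)
      have e2 := haar_isInvariantIntegral.toIsInvariantFunctional.sum_mul_smul_antipode k l i j
      simp only [map_sum, map_smul] at e1
      simp only [haar_mul_comm (matCoeff A k l)] at e2
      simp only [smul_sub, Finset.sum_sub_distrib, e1, e2, haar_mul_comm (matCoeff A k _)]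
      simp
    have h2 : ∀ (f : Module.Dual ℂ A) (c : A), haar A (c * ∑ m,
        f (antipode ℂ (antipode ℂ (matCoeff A m l)) - matCoeff A m l) • matCoeff A k m) = 0 := by
      intro f c
      have : haar A ∘ₗ LinearMap.mulRight ℂ (∑ m,
          f (antipode ℂ (antipode ℂ (matCoeff A m l)) - matCoeff A m l) • matCoeff A k m) = 0 := by
        refine LinearMap.ext_matCoeff fun i j => ?_
        have := congrArg f (h1 i j)
        simpa [Finset.mul_sum, mul_comm] using this
      exact LinearMap.congr_fun this c
    refine sub_eq_zero.1 ((Module.forall_dual_apply_eq_zero_iff ℂ _).1 fun f => ?_)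
    -- take `c` to be the adjoint of the other factor in `h2`, and use that `φ` is faithful
    have h3 := congrArg (counit (R := ℂ)) (haar_posDef.2 _ (h2 f _))
    simpa using h3
  exact LinearMap.congr_fun h a

theorem antipodeEquiv_symm_apply (a : A) : (antipodeEquiv A).symm a = antipode ℂ a := by
  rw [LinearEquiv.symm_apply_eq]
  exact (antipode_antipode a).symm

theorem star_antipode (a : A) : star (antipode ℂ a) = antipode ℂ (star a) := by
  have h := antipodeEquiv_symm_apply (star a)
  change star (antipode ℂ (star (star a))) = _ at h
  rwa [star_star] at h

theorem sum_matCoeff_mul_antipode_swap (i j : Fin (Module.finrank ℂ A)) :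
    ∑ k, matCoeff A k j * antipode ℂ (matCoeff A i k) = if i = j then 1 else 0 := by
  have h := congrArg (antipode ℂ) (sum_mul_antipode_matCoeff i j)
  simp only [map_sum, antipode_mul_antidistrib, antipode_antipode] at h
  rw [h]
  split_ifs <;> simp

theorem sum_antipode_mul_matCoeff_swap (i j : Fin (Module.finrank ℂ A)) :
    ∑ k, antipode ℂ (matCoeff A k j) * matCoeff A i k = if i = j then 1 else 0 := by
  have h := congrArg (antipode ℂ) (sum_antipode_mul_matCoeff i j)
  simp only [map_sum, antipode_mul_antidistrib, antipode_antipode] at h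
  rw [h]
  split_ifs <;> simp

/-- Strong right invariance, `∑ φ(c a₍₂₎) S(a₍₁₎) = ∑ c₍₁₎ φ(c₍₂₎ a)`. -/
theorem IsInvariantFunctional.sum_mul_smul_antipode_right {φ : A →ₗ[ℂ] ℂ}
    (hφ : IsInvariantFunctional φ) (i j k l : Fin (Module.finrank ℂ A)) :
    ∑ m, φ (matCoeff A i j * matCoeff A m l) • antipode ℂ (matCoeff A k m) =
      ∑ n, φ (matCoeff A n j * matCoeff A k l) • matCoeff A i n := by
  have h : ∀ p, ∑ m, ∑ n, φ (matCoeff A n j * matCoeff A m l) •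
      (matCoeff A i n * matCoeff A p m) = φ (matCoeff A i j * matCoeff A p l) • (1 : A) := by
    intro p
    have := hφ.right_inv (matCoeff A i j * matCoeff A p l)
    rw [Bialgebra.comul_mul] at this
    rw [← this, Finset.sum_comm]
    simp [Finset.sum_mul_sum]
  calc _ = ∑ p, ∑ m, ∑ n, φ (matCoeff A n j * matCoeff A m l) •
      (matCoeff A i n * (matCoeff A p m * antipode ℂ (matCoeff A k p))) := by
        refine Finset.sum_congr rfl fun p _ => ?_
        rw [← one_mul (antipode ℂ _), ← smul_mul_assoc, ← h]
        simp only [Finset.sum_mul, smul_mul_assoc, mul_assoc, one_mul]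
    _ = ∑ n, ∑ m, φ (matCoeff A n j * matCoeff A m l) •
      (matCoeff A i n * ∑ p, (matCoeff A p m * antipode ℂ (matCoeff A k p))) := by
        simp only [Finset.mul_sum, Finset.smul_sum]
        exact Finset.sum_univ_rev _
    _ = _ := by
        simp [sum_matCoeff_mul_antipode_swap]

end HaarInvariance

/-! ### The regular representation of the quantum double -/

theorem rTensorAlgHom_tmul {A B : Type*} [AddCommGroup A] [Module ℂ A] [AddCommGroup B]
    [Module ℂ B] (f : Module.End ℂ A) (a : A) (b : B) :
    Module.End.rTensorAlgHom ℂ A B f (a ⊗ₜ b) = f a ⊗ₜ b := rfl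

namespace HopfPairing

variable {A : Type u} {B : Type v} [FiniteHopfCStarAlgebra A] [FiniteHopfCStarAlgebra B]
  (P : HopfPairing A B)

theorem form_mul_right (i j : Fin (Module.finrank ℂ A)) (b b' : B) :
    P.form (matCoeff A i j) (b * b') =
      ∑ k, P.form (matCoeff A i k) b * P.form (matCoeff A k j) b' := by
  rw [← P.form_comul_left]
  simp [tensorForm]

theorem form_mul_left (a a' : A) (i j : Fin (Module.finrank ℂ B)) :
    P.form (a * a') (matCoeff B i j) =
      ∑ k, P.form a (matCoeff B i k) * P.form a' (matCoeff B k j) := by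
  rw [← P.form_comul_right]
  simp [tensorForm]

/-- The slice map `a₁ ⊗ a₂ ↦ ⟨a₂, b⟩ a₁`. -/
noncomputable def sliceRight (b : B) : A ⊗[ℂ] A →ₗ[ℂ] A :=
  (TensorProduct.rid ℂ A).toLinearMap ∘ₗ (P.form.flip b).lTensor A

/-- The slice map `a₁ ⊗ a₂ ↦ ⟨a₁, b⟩ a₂`. -/
noncomputable def sliceLeft (b : B) : A ⊗[ℂ] A →ₗ[ℂ] A :=
  (TensorProduct.lid ℂ A).toLinearMap ∘ₗ (P.form.flip b).rTensor A

@[simp]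
theorem sliceRight_tmul (b : B) (x y : A) : P.sliceRight b (x ⊗ₜ y) = P.form y b • x := by
  simp [sliceRight]

@[simp]
theorem sliceLeft_tmul (b : B) (x y : A) : P.sliceLeft b (x ⊗ₜ y) = P.form x b • y := by
  simp [sliceLeft]

theorem sliceRight_add (b b' : B) : P.sliceRight (b + b') = P.sliceRight b + P.sliceRight b' := by
  ext; simp [add_smul]

theorem sliceRight_smul (c : ℂ) (b : B) : P.sliceRight (c • b) = c • P.sliceRight b := by
  ext; simp [mul_smul]

theorem sliceLeft_add (b b' : B) : P.sliceLeft (b + b') = P.sliceLeft b + P.sliceLeft b' := by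
  ext; simp [add_smul]

theorem sliceLeft_smul (c : ℂ) (b : B) : P.sliceLeft (c • b) = c • P.sliceLeft b := by
  ext; simp [mul_smul]

/-- The left action `b ▷ a = ∑ ⟨a₍₂₎, b⟩ a₍₁₎` of `B` on `A`. -/
noncomputable def leftAct : B →ₐ[ℂ] Module.End ℂ A :=
  AlgHom.ofLinearMap
    { toFun := fun b => P.sliceRight b ∘ₗ comul
      map_add' := fun b b' => by rw [sliceRight_add, LinearMap.add_comp]
      map_smul' := fun c b => by rw [sliceRight_smul, LinearMap.smul_comp, RingHom.id_apply] }
    (by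
      refine LinearMap.ext_matCoeff fun i j => ?_
      simp [P.form_one_right])
    (fun b b' => by
      refine LinearMap.ext_matCoeff fun i j => ?_
      simp only [LinearMap.coe_mk, AddHom.coe_mk, LinearMap.comp_apply, Module.End.mul_apply,
        comul_matCoeff, map_sum, sliceRight_tmul, map_smul, form_mul_right, Finset.smul_sum,
        Finset.sum_smul, smul_smul]
      rw [Finset.sum_comm]
      simp only [mul_comm])

/-- The left action `b, a ↦ ∑ ⟨a₍₁₎, S b⟩ a₍₂₎` of `B` on `A`. -/
noncomputable def rightAct : B →ₐ[ℂ] Module.End ℂ A :=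
  AlgHom.ofLinearMap
    { toFun := fun b => P.sliceLeft (antipode ℂ b) ∘ₗ comul
      map_add' := fun b b' => by rw [map_add, sliceLeft_add, LinearMap.add_comp]
      map_smul' := fun c b => by
        rw [map_smul, sliceLeft_smul, LinearMap.smul_comp, RingHom.id_apply] }
    (by
      refine LinearMap.ext_matCoeff fun i j => ?_
      simp [P.form_one_right])
    (fun b b' => by
      refine LinearMap.ext_matCoeff fun i j => ?_
      simp only [LinearMap.coe_mk, AddHom.coe_mk, LinearMap.comp_apply, Module.End.mul_apply,
        comul_matCoeff, map_sum, sliceLeft_tmul, map_smul, form_mul_right, Finset.smul_sum,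
        Finset.sum_smul, smul_smul, antipode_mul_antidistrib]
      rw [Finset.sum_comm])

theorem leftAct_apply (b : B) (a : A) : P.leftAct b a = P.sliceRight b (comul a) := rfl

theorem rightAct_apply (b : B) (a : A) :
    P.rightAct b a = P.sliceLeft (antipode ℂ b) (comul a) := rfl

theorem leftAct_matCoeff (b : B) (i j : Fin (Module.finrank ℂ A)) :
    P.leftAct b (matCoeff A i j) = ∑ k, P.form (matCoeff A k j) b • matCoeff A i k := by
  simp [leftAct_apply]

theorem rightAct_matCoeff (b : B) (i j : Fin (Module.finrank ℂ A)) :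
    P.rightAct b (matCoeff A i j) =
      ∑ k, P.form (matCoeff A i k) (antipode ℂ b) • matCoeff A k j := by
  simp [rightAct_apply]

theorem commute_leftAct_rightAct (b b' : B) : Commute (P.leftAct b) (P.rightAct b') := by
  refine LinearMap.ext_matCoeff fun i j => ?_
  simp only [Module.End.mul_apply, leftAct_matCoeff, rightAct_matCoeff, map_sum, map_smul,
    Finset.smul_sum, smul_smul]
  rw [Finset.sum_comm]
  simp only [mul_comm]

theorem leftAct_one_right (b : B) : P.leftAct b 1 = counit (R := ℂ) b • (1 : A) := by
  simp [leftAct_apply, Algebra.TensorProduct.one_def, P.form_one_left]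

theorem rightAct_one_right (b : B) : P.rightAct b 1 = counit (R := ℂ) b • (1 : A) := by
  simp [rightAct_apply, Algebra.TensorProduct.one_def, P.form_one_left]

/-- `b ▷ (a x) = ∑ (b₍₁₎ ▷ a) (b₍₂₎ ▷ x)`. -/
theorem leftAct_mul (i j : Fin (Module.finrank ℂ B)) (a x : A) :
    P.leftAct (matCoeff B i j) (a * x) =
      ∑ k, P.leftAct (matCoeff B i k) a * P.leftAct (matCoeff B k j) x := by
  simp only [leftAct_apply, Bialgebra.comul_mul]
  generalize comul (R := ℂ) a = y
  generalize comul (R := ℂ) x = z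
  induction y with
  | zero => simp
  | add x y hx hy => simp only [map_add, add_mul, hx, hy, Finset.sum_add_distrib]
  | tmul a a' =>
    induction z with
    | zero => simp
    | add x y hx hy => simp only [map_add, mul_add, hx, hy, Finset.sum_add_distrib]
    | tmul x x' =>
      simp [form_mul_left, Finset.sum_smul, smul_smul, mul_comm]

/-- For the right action of `S(b)`: `(a x) ◁ S(b) = ∑ (a ◁ S(b₍₂₎)) (x ◁ S(b₍₁₎))`. -/
theorem rightAct_mul (i j : Fin (Module.finrank ℂ B)) (a x : A) :
    P.rightAct (matCoeff B i j) (a * x) =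
      ∑ k, P.rightAct (matCoeff B k j) a * P.rightAct (matCoeff B i k) x := by
  simp only [rightAct_apply, Bialgebra.comul_mul]
  generalize comul (R := ℂ) a = y
  generalize comul (R := ℂ) x = z
  induction y with
  | zero => simp
  | add x y hx hy => simp only [map_add, add_mul, hx, hy, Finset.sum_add_distrib]
  | tmul a a' =>
    induction z with
    | zero => simp
    | add x y hx hy => simp only [map_add, mul_add, hx, hy, Finset.sum_add_distrib]
    | tmul x x' =>
      simp [← form_antipode, antipode_mul_antidistrib, form_mul_left, Finset.sum_smul, smul_smul,
        mul_comm]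

/-- The action of `A` on `A ⊗ B` by left multiplication on the first leg. -/
noncomputable def repA (A : Type u) (B : Type v) [FiniteHopfCStarAlgebra A]
    [FiniteHopfCStarAlgebra B] : A →ₐ[ℂ] Module.End ℂ (A ⊗[ℂ] B) :=
  (Module.End.rTensorAlgHom ℂ A B).comp (Algebra.lmul ℂ A)

theorem commute_lmul_rightAct (b b' : B) :
    Commute (((Module.End.lTensorAlgHom ℂ B A).comp (Algebra.lmul ℂ B)) b)
      (((Module.End.rTensorAlgHom ℂ A B).comp P.rightAct) b') :=
  TensorProduct.ext' fun _ _ => rfl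

/-- The commuting actions of `B` on `A ⊗ B` by left multiplication on the second leg and by
the right action of `S(b)` on the first leg, as a representation of `B ⊗ B`. -/
noncomputable def repTwo : B ⊗[ℂ] B →ₐ[ℂ] Module.End ℂ (A ⊗[ℂ] B) :=
  Algebra.TensorProduct.lift ((Module.End.lTensorAlgHom ℂ B A).comp (Algebra.lmul ℂ B))
    ((Module.End.rTensorAlgHom ℂ A B).comp P.rightAct) P.commute_lmul_rightAct

theorem repTwo_tmul (y z : B) (a : A) (b : B) :
    P.repTwo (y ⊗ₜ z) (a ⊗ₜ b) = P.rightAct z a ⊗ₜ (y * b) := by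
  rw [repTwo, Algebra.TensorProduct.lift_tmul]
  rfl

theorem commute_leftAct_repTwo (b : B) (y : B ⊗[ℂ] B) :
    Commute (((Module.End.rTensorAlgHom ℂ A B).comp P.leftAct) b) (P.repTwo y) := by
  induction y with
  | zero => simp
  | add y z hy hz => rw [map_add]; exact hy.add_right hz
  | tmul y z =>
    refine TensorProduct.ext' fun a b' => ?_
    rw [Module.End.mul_apply, Module.End.mul_apply, repTwo_tmul, AlgHom.comp_apply,
      rTensorAlgHom_tmul, rTensorAlgHom_tmul, repTwo_tmul]
    exact congrArg (· ⊗ₜ[ℂ] (y * b')) (LinearMap.congr_fun (P.commute_leftAct_rightAct b z).eq a)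

/-- The action `▷` of `B` on the first leg commutes with `repTwo`; together they are a
representation of `B ⊗ (B ⊗ B)` on `A ⊗ B`. -/
noncomputable def repThree : B ⊗[ℂ] (B ⊗[ℂ] B) →ₐ[ℂ] Module.End ℂ (A ⊗[ℂ] B) :=
  Algebra.TensorProduct.lift ((Module.End.rTensorAlgHom ℂ A B).comp P.leftAct) P.repTwo
    P.commute_leftAct_repTwo

theorem repThree_tmul (x y z : B) (a : A) (b : B) :
    P.repThree (x ⊗ₜ (y ⊗ₜ z)) (a ⊗ₜ b) = P.leftAct x (P.rightAct z a) ⊗ₜ (y * b) := by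
  rw [repThree, Algebra.TensorProduct.lift_tmul, Module.End.mul_apply, repTwo_tmul]
  rfl

/-- The action of `B` on `A ⊗ B`, `b · (a ⊗ b') = ∑ (b₍₁₎ ▷ a ◁ S(b₍₃₎)) ⊗ b₍₂₎ b'`. -/
noncomputable def repB : B →ₐ[ℂ] Module.End ℂ (A ⊗[ℂ] B) :=
  P.repThree.comp ((Algebra.TensorProduct.map (AlgHom.id ℂ B) (Bialgebra.comulAlgHom ℂ B)).comp
    (Bialgebra.comulAlgHom ℂ B))

theorem repB_apply (b : B) : P.repB b = P.repThree (comulThree B b) := rfl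

theorem repB_matCoeff (i j : Fin (Module.finrank ℂ B)) (a : A) (b : B) :
    P.repB (matCoeff B i j) (a ⊗ₜ b) =
      ∑ k, ∑ l, P.leftAct (matCoeff B i k) (P.rightAct (matCoeff B l j) a) ⊗ₜ
        (matCoeff B k l * b) := by
  simp [repB_apply, comulThree, repThree_tmul, TensorProduct.tmul_sum]

@[simp]
theorem repA_apply (a a' : A) (b : B) : repA A B a (a' ⊗ₜ b) = (a * a') ⊗ₜ b := rfl

theorem repB_one_tmul (b b' : B) : P.repB b (1 ⊗ₜ b') = 1 ⊗ₜ (b * b') := by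
  have : LinearMap.applyₗ ((1 : A) ⊗ₜ[ℂ] b') ∘ₗ P.repB.toLinearMap =
      TensorProduct.mk ℂ A B 1 ∘ₗ LinearMap.mulRight ℂ b' := by
    refine LinearMap.ext_matCoeff fun i j => ?_
    simp only [LinearMap.comp_apply, LinearMap.applyₗ_apply_apply, AlgHom.toLinearMap_apply,
      repB_matCoeff, rightAct_one_right, leftAct_one_right, map_smul, counit_matCoeff]
    simp [ite_smul, TensorProduct.ite_tmul]
  exact LinearMap.congr_fun this b

/-- The representation of `D(A, B)` on `A ⊗ B`, which is `(a, b) ↦ repA a * repB b`. -/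
noncomputable def rep : A ⊗[ℂ] B →ₗ[ℂ] Module.End ℂ (A ⊗[ℂ] B) :=
  LinearMap.mul' ℂ _ ∘ₗ TensorProduct.map (repA A B).toLinearMap P.repB.toLinearMap

theorem rep_tmul (a : A) (b : B) : P.rep (a ⊗ₜ b) = repA A B a * P.repB b := by
  simp [rep]

theorem rep_repA_apply (a : A) (x : A ⊗[ℂ] B) :
    P.rep (repA A B a x) = repA A B a * P.rep x := by
  induction x with
  | zero => simp
  | add x y hx hy => simp only [map_add, mul_add, hx, hy]
  | tmul a' b => simp [rep_tmul, mul_assoc]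

theorem rep_lTensor_mulRight (b : B) (x : A ⊗[ℂ] B) :
    P.rep ((LinearMap.mulRight ℂ b).lTensor A x) = P.rep x * P.repB b := by
  induction x with
  | zero => simp
  | add x y hx hy => simp only [map_add, add_mul, hx, hy]
  | tmul a' b => simp [rep_tmul, mul_assoc]

theorem rep_apply_one_tmul (x : A ⊗[ℂ] B) (b : B) :
    P.rep x (1 ⊗ₜ b) = (LinearMap.mulRight ℂ b).lTensor A x := by
  induction x with
  | zero => simp
  | add x y hx hy => simp only [map_add, LinearMap.add_apply, hx, hy]
  | tmul a' b => simp [rep_tmul, repB_one_tmul]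

theorem rep_apply_one (x : A ⊗[ℂ] B) : P.rep x (1 ⊗ₜ 1) = x := by
  rw [rep_apply_one_tmul]
  simp

/-- The exchange map on matrix coefficients, with `S` in place of `S⁻¹` as `S² = 1`. -/
theorem exchange_matCoeff (i j : Fin (Module.finrank ℂ B)) (p q : Fin (Module.finrank ℂ A)) :
    P.exchange (matCoeff B i j ⊗ₜ matCoeff A p q) =
      ∑ l, ∑ k, ∑ r, ∑ s, (P.form (matCoeff A p r) (antipode ℂ (matCoeff B l j)) *
        P.form (matCoeff A s q) (matCoeff B i k)) • (matCoeff A r s ⊗ₜ[ℂ] matCoeff B k l) := by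
  simp only [exchange, LinearMap.comp_apply, LinearEquiv.coe_coe, TensorProduct.comm_tmul,
    TensorProduct.map_tmul, comulThree, comulThreeOp, comulOp, comul_matCoeff, map_sum,
    LinearMap.lTensor_tmul, TensorProduct.tmul_sum, TensorProduct.sum_tmul, contract_tmul,
    antipodeEquiv_symm_apply]

/-- The exchange relation of the quantum double holds for the actions of `B` and `A`. -/
theorem repB_mul_repA (b : B) (a : A) :
    P.repB b * repA A B a = P.rep (P.exchange (b ⊗ₜ a)) := by
  have h : ∀ (i j : Fin (Module.finrank ℂ B)) (p q : Fin (Module.finrank ℂ A)),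
      P.repB (matCoeff B i j) * repA A B (matCoeff A p q) =
        P.rep (P.exchange (matCoeff B i j ⊗ₜ matCoeff A p q)) := by
    intro i j p q
    refine TensorProduct.ext' fun x y => ?_
    simp only [exchange_matCoeff, map_sum, map_smul, rep_tmul, LinearMap.sum_apply,
      LinearMap.smul_apply, Module.End.mul_apply, repA_apply, repB_matCoeff, rightAct_mul,
      leftAct_mul, leftAct_matCoeff, rightAct_matCoeff, Finset.sum_mul, smul_mul_assoc,
      Finset.smul_sum, smul_smul, TensorProduct.sum_tmul, TensorProduct.smul_tmul']
    exact Finset.sum_univ_reorder _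
  have h2 : LinearMap.compl₁₂ (LinearMap.mul ℂ (Module.End ℂ (A ⊗[ℂ] B))) P.repB.toLinearMap
      (repA A B).toLinearMap = TensorProduct.curry (P.rep ∘ₗ P.exchange) :=
    LinearMap.ext_matCoeff fun i j => LinearMap.ext_matCoeff fun p q => h i j p q
  exact LinearMap.congr_fun (LinearMap.congr_fun h2 b) a

theorem rep_tmul_tmul (a a' : A) (b b' : B) :
    P.rep (a ⊗ₜ b) (a' ⊗ₜ b') = repA A B a (P.rep (P.exchange (b ⊗ₜ a')) (1 ⊗ₜ b')) := by
  rw [← repB_mul_repA, rep_tmul]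
  simp

/-- The left regular representation is `rep`. -/
theorem doubleMul_eq (x y : A ⊗[ℂ] B) : P.doubleMul x y = P.rep x y := by
  induction x with
  | zero => simp
  | add x z hx hz => simp only [map_add, LinearMap.add_apply, hx, hz]
  | tmul a b =>
    induction y with
    | zero => simp
    | add x z hx hz => simp only [map_add, hx, hz]
    | tmul a' b' =>
      rw [rep_tmul_tmul, rep_apply_one_tmul]
      simp only [doubleMul, TensorProduct.curry_apply, LinearMap.comp_apply, LinearEquiv.coe_coe,
        TensorProduct.assoc_tmul, LinearMap.lTensor_tmul, TensorProduct.assoc_symm_tmul,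
        LinearMap.rTensor_tmul]
      generalize P.exchange (b ⊗ₜ a') = z
      induction z with
      | zero => simp
      | add x z hx hz => simp only [map_add, TensorProduct.add_tmul, TensorProduct.tmul_add, hx, hz]
      | tmul c d => simp

/-- `rep` is multiplicative, which gives the associativity of the product of the quantum double. -/
theorem rep_doubleMul (x y : A ⊗[ℂ] B) : P.rep (P.doubleMul x y) = P.rep x * P.rep y := by
  rw [doubleMul_eq]
  induction x with
  | zero => simp
  | add x z hx hz => simp only [map_add, LinearMap.add_apply, add_mul, hx, hz]
  | tmul a b =>
    induction y with
    | zero => simp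
    | add x z hx hz => simp only [map_add, mul_add, hx, hz]
    | tmul a' b' =>
      rw [rep_tmul_tmul, rep_apply_one_tmul, rep_repA_apply, rep_lTensor_mulRight, ← repB_mul_repA,
        rep_tmul, rep_tmul]
      simp only [mul_assoc]

end HopfPairing

/-! ### The regular representation is a `*`-representation -/

namespace HopfPairing

variable {A : Type u} {B : Type v} [FiniteHopfCStarAlgebra A] [FiniteHopfCStarAlgebra B]
  (P : HopfPairing A B)

theorem star_form (a : A) (b : B) :
    star (P.form a b) = P.form (star a) (antipode ℂ (star b)) := by
  rw [P.form_star, antipode_antipode, star_star]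

theorem star_leftAct (b : B) (a : A) :
    star (P.leftAct b a) = P.leftAct (antipode ℂ (star b)) (star a) := by
  rw [leftAct_apply, leftAct_apply, FiniteHopfCStarAlgebra.comul_star]
  generalize comul (R := ℂ) a = z
  induction z with
  | zero => simp
  | add x y hx hy => simp only [map_add, star_add, hx, hy]
  | tmul x y => rw [sliceRight_tmul, star_smul, star_form, TensorProduct.star_tmul, sliceRight_tmul]

theorem star_rightAct (b : B) (a : A) :
    star (P.rightAct b a) = P.rightAct (antipode ℂ (star b)) (star a) := by
  rw [rightAct_apply, rightAct_apply, FiniteHopfCStarAlgebra.comul_star]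
  generalize comul (R := ℂ) a = z
  induction z with
  | zero => simp
  | add x y hx hy => simp only [map_add, star_add, hx, hy]
  | tmul x y =>
    rw [sliceLeft_tmul, star_smul, star_form, TensorProduct.star_tmul, sliceLeft_tmul,
      star_antipode]

/-- Strong left invariance as an adjointness relation for the action `▷`. -/
theorem invariant_leftAct {φ : A →ₗ[ℂ] ℂ} (hφ : IsInvariantFunctional φ) (b : B) (c a : A) :
    φ (P.leftAct (antipode ℂ b) c * a) = φ (c * P.leftAct b a) := by
  have : (LinearMap.mul ℂ A).compr₂ φ ∘ₗ P.leftAct (antipode ℂ b) =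
      ((LinearMap.mul ℂ A).compr₂ φ).compl₂ (P.leftAct b) := by
    refine LinearMap.ext_matCoeff fun i j => LinearMap.ext_matCoeff fun k l => ?_
    have h := congrArg (fun x => P.form x (antipode ℂ b)) (hφ.sum_mul_smul_antipode i j k l)
    simp only [map_sum, map_smul, LinearMap.sum_apply, LinearMap.smul_apply, P.form_antipode,
      antipode_antipode, smul_eq_mul] at h
    change φ (P.leftAct _ _ * _) = φ (_ * P.leftAct _ _)
    simp only [leftAct_matCoeff, Finset.sum_mul, Finset.mul_sum, map_sum,
      smul_mul_assoc, mul_smul_comm, map_smul, smul_eq_mul]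
    simpa only [mul_comm] using h.symm
  exact LinearMap.congr_fun (LinearMap.congr_fun this c) a

/-- Strong right invariance as an adjointness relation for the action from the right. -/
theorem invariant_rightAct {φ : A →ₗ[ℂ] ℂ} (hφ : IsInvariantFunctional φ) (b : B) (c a : A) :
    φ (P.rightAct (antipode ℂ b) c * a) = φ (c * P.rightAct b a) := by
  have : (LinearMap.mul ℂ A).compr₂ φ ∘ₗ P.rightAct (antipode ℂ b) =
      ((LinearMap.mul ℂ A).compr₂ φ).compl₂ (P.rightAct b) := by
    refine LinearMap.ext_matCoeff fun i j => LinearMap.ext_matCoeff fun k l => ?_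
    have h := congrArg (fun x => P.form x b) (hφ.sum_mul_smul_antipode_right i j k l)
    simp only [map_sum, map_smul, LinearMap.sum_apply, LinearMap.smul_apply, P.form_antipode,
      smul_eq_mul] at h
    change φ (P.rightAct _ _ * _) = φ (_ * P.rightAct _ _)
    simp only [rightAct_matCoeff, Finset.sum_mul, Finset.mul_sum, map_sum,
      smul_mul_assoc, mul_smul_comm, map_smul, smul_eq_mul, antipode_antipode]
    simpa only [mul_comm] using h.symm
  exact LinearMap.congr_fun (LinearMap.congr_fun this c) a

theorem invariant_star_leftAct {φ : A →ₗ[ℂ] ℂ} (hφ : IsInvariantFunctional φ) (b : B) (c a : A) :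
    φ (star (P.leftAct b c) * a) = φ (star c * P.leftAct (star b) a) := by
  rw [star_leftAct, P.invariant_leftAct hφ]

theorem invariant_star_rightAct {φ : A →ₗ[ℂ] ℂ} (hφ : IsInvariantFunctional φ) (b : B) (c a : A) :
    φ (star (P.rightAct b c) * a) = φ (star c * P.rightAct (star b) a) := by
  rw [star_rightAct, P.invariant_rightAct hφ]

section Adjoint

variable {φ : A →ₗ[ℂ] ℂ} {ψ : B →ₗ[ℂ] ℂ}

/-- `T` and `T'` are adjoint for the sesquilinear form `(x, y) ↦ (φ ⊗ ψ)(x^* y)`, where the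
product and the involution are those of the tensor product `A ⊗ B`. -/
def IsAdjoint (φ : A →ₗ[ℂ] ℂ) (ψ : B →ₗ[ℂ] ℂ) (T T' : Module.End ℂ (A ⊗[ℂ] B)) : Prop :=
  ∀ x y, tensorFunctional φ ψ (star (T x) * y) = tensorFunctional φ ψ (star x * T' y)

theorem IsAdjoint.mul {S S' T T' : Module.End ℂ (A ⊗[ℂ] B)} (hS : IsAdjoint φ ψ S S')
    (hT : IsAdjoint φ ψ T T') : IsAdjoint φ ψ (S * T) (T' * S') := fun x y => by
  rw [Module.End.mul_apply, hS, hT, Module.End.mul_apply]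

theorem IsAdjoint.add {S S' T T' : Module.End ℂ (A ⊗[ℂ] B)} (hS : IsAdjoint φ ψ S S')
    (hT : IsAdjoint φ ψ T T') : IsAdjoint φ ψ (S + T) (S' + T') := fun x y => by
  rw [LinearMap.add_apply, LinearMap.add_apply, star_add, add_mul, mul_add, map_add, map_add, hS,
    hT]

theorem IsAdjoint.zero : IsAdjoint φ ψ (0 : Module.End ℂ (A ⊗[ℂ] B)) 0 := fun x y => by simp

theorem IsAdjoint.of_tmul {T T' : Module.End ℂ (A ⊗[ℂ] B)}
    (h : ∀ a b a' b', tensorFunctional φ ψ (star (T (a ⊗ₜ b)) * (a' ⊗ₜ b')) =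
      tensorFunctional φ ψ (star (a ⊗ₜ b) * T' (a' ⊗ₜ b'))) : IsAdjoint φ ψ T T' := by
  intro x y
  induction x with
  | zero => simp
  | add x z hx hz => simp only [map_add, star_add, add_mul, hx, hz]
  | tmul a b =>
    induction y with
    | zero => simp
    | add x z hx hz => simp only [map_add, mul_add, hx, hz]
    | tmul a' b' => exact h a b a' b'

theorem isAdjoint_repA (a : A) : IsAdjoint φ ψ (repA A B a) (repA A B (star a)) :=
  .of_tmul fun c b a' b' => by simp [mul_assoc]

theorem isAdjoint_repThree (hφ : IsInvariantFunctional φ) (z : B ⊗[ℂ] (B ⊗[ℂ] B)) :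
    IsAdjoint φ ψ (P.repThree z) (P.repThree (star z)) := by
  induction z with
  | zero => rw [star_zero, map_zero]; exact .zero
  | add x y hx hy => rw [star_add, map_add, map_add]; exact hx.add hy
  | tmul x y =>
    induction y with
    | zero => rw [TensorProduct.tmul_zero, star_zero, map_zero]; exact .zero
    | add y z hy hz =>
      rw [TensorProduct.tmul_add, star_add, map_add, map_add]; exact hy.add hz
    | tmul y z =>
      refine .of_tmul fun a b a' b' => ?_
      simp only [TensorProduct.star_tmul, repThree_tmul, Algebra.TensorProduct.tmul_mul_tmul,
        tensorFunctional_tmul, P.invariant_star_leftAct hφ, P.invariant_star_rightAct hφ, star_mul,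
        mul_assoc]
      have h := LinearMap.congr_fun (P.commute_leftAct_rightAct (star x) (star z)).eq a'
      simp only [Module.End.mul_apply] at h
      rw [h]

theorem comulThree_star (b : B) : comulThree B (star b) = star (comulThree B b) := by
  simp only [comulThree, LinearMap.comp_apply, FiniteHopfCStarAlgebra.comul_star]
  generalize comul (R := ℂ) b = z
  induction z with
  | zero => simp
  | add x y hx hy => simp only [map_add, star_add, hx, hy]
  | tmul x y => simp [FiniteHopfCStarAlgebra.comul_star]

theorem isAdjoint_repB (hφ : IsInvariantFunctional φ) (b : B) :
    IsAdjoint φ ψ (P.repB b) (P.repB (star b)) := by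
  rw [repB_apply, repB_apply, comulThree_star]
  exact P.isAdjoint_repThree hφ _

theorem doubleStar_tmul (a : A) (b : B) :
    P.doubleStar (a ⊗ₜ b) = P.exchange (star b ⊗ₜ star a) := by
  simp [doubleStar]

/-- The involution of the quantum double is the adjoint in the regular representation. -/
theorem isAdjoint_rep (hφ : IsInvariantFunctional φ) (x : A ⊗[ℂ] B) :
    IsAdjoint φ ψ (P.rep x) (P.rep (P.doubleStar x)) := by
  induction x with
  | zero => simpa [doubleStar] using IsAdjoint.zero
  | add x y hx hy =>
    have : P.doubleStar (x + y) = P.doubleStar x + P.doubleStar y := by simp [doubleStar]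
    rw [this, map_add, map_add]
    exact hx.add hy
  | tmul a b =>
    rw [doubleStar_tmul, ← repB_mul_repA, rep_tmul]
    exact (isAdjoint_repA a).mul (P.isAdjoint_repB hφ b)

end Adjoint

end HopfPairing

/-! ### The Hopf algebra structure of the quantum double -/

namespace HopfPairing

variable {A : Type u} {B : Type v} [FiniteHopfCStarAlgebra A] [FiniteHopfCStarAlgebra B]
  (P : HopfPairing A B)

/-- The commutation relation of the quantum double,
`∑ ⟨a₍₁₎, b₍₂₎⟩ b₍₁₎ a₍₂₎ = ∑ ⟨a₍₂₎, b₍₁₎⟩ a₍₁₎ b₍₂₎`, for two maps into an algebra. -/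
def ExchangeRelation {R : Type*} [Ring R] [Algebra ℂ R] (α : A →ₐ[ℂ] R) (β : B →ₐ[ℂ] R) : Prop :=
  ∀ p q i j, ∑ r, ∑ k, P.form (matCoeff A p r) (matCoeff B k j) •
      (β (matCoeff B i k) * α (matCoeff A r q)) =
    ∑ r, ∑ k, P.form (matCoeff A r q) (matCoeff B i k) •
      (α (matCoeff A p r) * β (matCoeff B k j))

/-- The linear map `(a, b) ↦ α(a) β(b)`. -/
noncomputable def liftDouble {R : Type*} [Ring R] [Algebra ℂ R] (α : A →ₐ[ℂ] R) (β : B →ₐ[ℂ] R) :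
    A ⊗[ℂ] B →ₗ[ℂ] R :=
  LinearMap.mul' ℂ R ∘ₗ TensorProduct.map α.toLinearMap β.toLinearMap

@[simp]
theorem liftDouble_tmul {R : Type*} [Ring R] [Algebra ℂ R] (α : A →ₐ[ℂ] R) (β : B →ₐ[ℂ] R)
    (a : A) (b : B) : liftDouble α β (a ⊗ₜ b) = α a * β b := by
  simp [liftDouble]

/-- `⟨a, b⟩` and `⟨a, S(b)⟩` are inverse to each other for the convolution of forms on `A` and the
opposite coalgebra of `B`. -/
theorem sum_form_mul_form_antipode (p s : Fin (Module.finrank ℂ A))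
    (l j : Fin (Module.finrank ℂ B)) :
    ∑ r, ∑ k, P.form (matCoeff A p r) (matCoeff B k j) *
      P.form (matCoeff A r s) (antipode ℂ (matCoeff B l k)) =
        if p = s then (if l = j then 1 else 0) else 0 := by
  rw [Finset.sum_comm]
  simp only [← form_mul_right, ← map_sum, sum_matCoeff_mul_antipode_swap]
  split_ifs <;> simp_all [P.form_one_right]

theorem sum_form_antipode_mul_form (p s : Fin (Module.finrank ℂ A))
    (k j : Fin (Module.finrank ℂ B)) :
    ∑ r, ∑ l, P.form (matCoeff A p r) (antipode ℂ (matCoeff B l j)) *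
      P.form (matCoeff A r s) (matCoeff B k l) =
        if p = s then (if k = j then 1 else 0) else 0 := by
  rw [Finset.sum_comm]
  simp only [← form_mul_right, ← map_sum, sum_antipode_mul_matCoeff_swap]
  split_ifs <;> simp_all [P.form_one_right]

/-- The commutation relation determines the products `β(b) α(a)`: they are given by the exchange
map. -/
theorem ExchangeRelation.mul_eq {R : Type*} [Ring R] [Algebra ℂ R] {α : A →ₐ[ℂ] R}
    {β : B →ₐ[ℂ] R} (h : P.ExchangeRelation α β) (b : B) (a : A) :
    β b * α a = liftDouble α β (P.exchange (b ⊗ₜ a)) := by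
  have key : (LinearMap.mul ℂ R).compl₁₂ β.toLinearMap α.toLinearMap =
      TensorProduct.curry (liftDouble α β ∘ₗ P.exchange) := by
    refine LinearMap.ext_matCoeff fun i j => LinearMap.ext_matCoeff fun p q => ?_
    change β (matCoeff B i j) * α (matCoeff A p q) = 
      liftDouble α β (P.exchange (matCoeff B i j ⊗ₜ matCoeff A p q))
    rw [exchange_matCoeff]
    simp only [map_sum, map_smul, liftDouble_tmul]
    calc β (matCoeff B i j) * α (matCoeff A p q)
        = ∑ r, ∑ l, P.form (matCoeff A p r) (antipode ℂ (matCoeff B l j)) •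
          ∑ s, ∑ k, P.form (matCoeff A r s) (matCoeff B k l) •
            (β (matCoeff B i k) * α (matCoeff A s q)) := by
          simp only [Finset.smul_sum, smul_smul]
          rw [Finset.sum_univ_pair_comm]
          simp only [← Finset.sum_smul, sum_form_antipode_mul_form, ite_smul, zero_smul, one_smul]
          simp
      _ = _ := by
          simp only [h _ _ _ _, Finset.smul_sum, smul_smul]
          exact Finset.sum_univ_reorder_four _
  exact LinearMap.congr_fun (LinearMap.congr_fun key b) a

/-- The exchange relation and multiplicativity of `α` and `β` make `liftDouble α β`
multiplicative for the product of the quantum double. -/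
theorem ExchangeRelation.map_doubleMul {R : Type*} [Ring R] [Algebra ℂ R] {α : A →ₐ[ℂ] R}
    {β : B →ₐ[ℂ] R} (h : P.ExchangeRelation α β) (x y : A ⊗[ℂ] B) :
    liftDouble α β (P.doubleMul x y) = liftDouble α β x * liftDouble α β y := by
  rw [doubleMul_eq]
  induction x with
  | zero => simp
  | add x z hx hz => simp only [map_add, LinearMap.add_apply, add_mul, hx, hz]
  | tmul a b =>
    induction y with
    | zero => simp
    | add x z hx hz => simp only [map_add, mul_add, hx, hz]
    | tmul a' b' =>
      have h2 : ∀ z : A ⊗[ℂ] B, liftDouble α β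
          (repA A B a ((LinearMap.mulRight ℂ b').lTensor A z)) =
          α a * liftDouble α β z * β b' := by
        intro z
        induction z with
        | zero => simp
        | add x y hx hy => simp only [map_add, mul_add, add_mul, hx, hy]
        | tmul c d => simp [mul_assoc]
      rw [rep_tmul_tmul, rep_apply_one_tmul, h2, ← h.mul_eq]
      simp [mul_assoc]

section DoubleAlgebra

variable {H : Type*} [CStarAlgebra H] {e : A ⊗[ℂ] B ≃ₗ[ℂ] H}

/-- The linear bijection `e` carries the product, the unit and the involution of the quantum
double to those of `H`. -/
structure IsDoubleAlgIso (P : HopfPairing A B) (e : A ⊗[ℂ] B ≃ₗ[ℂ] H) : Prop where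
  map_mul : ∀ x y, e (P.doubleMul x y) = e x * e y
  map_one : e (1 ⊗ₜ[ℂ] 1) = 1
  map_star : ∀ x, e (P.doubleStar x) = star (e x)

namespace IsDoubleAlgIso

variable {P} (he : P.IsDoubleAlgIso e)

/-- The embedding `a ↦ (a, 1)`. -/
noncomputable def inlA (he : P.IsDoubleAlgIso e) : A →ₐ[ℂ] H :=
  AlgHom.ofLinearMap (e.toLinearMap ∘ₗ (TensorProduct.mk ℂ A B).flip 1) he.map_one (fun a a' => by
    change e _ = e _ * e _
    rw [← he.map_mul, doubleMul_eq]
    simp [rep_tmul])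

/-- The embedding `b ↦ (1, b)`. -/
noncomputable def inrB (he : P.IsDoubleAlgIso e) : B →ₐ[ℂ] H :=
  AlgHom.ofLinearMap (e.toLinearMap ∘ₗ TensorProduct.mk ℂ A B 1) he.map_one (fun b b' => by
    change e _ = e _ * e _
    rw [← he.map_mul, doubleMul_eq]
    simp [rep_tmul, repB_one_tmul])

theorem inlA_apply (a : A) : he.inlA a = e (a ⊗ₜ 1) := rfl

theorem inrB_apply (b : B) : he.inrB b = e (1 ⊗ₜ b) := rfl

theorem inlA_mul_inrB (a : A) (b : B) : he.inlA a * he.inrB b = e (a ⊗ₜ b) := by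
  rw [inlA_apply, inrB_apply, ← he.map_mul, doubleMul_eq]
  simp [rep_tmul]

theorem inrB_mul_inlA (b : B) (a : A) : he.inrB b * he.inlA a = e (P.exchange (b ⊗ₜ a)) := by
  rw [inlA_apply, inrB_apply, ← he.map_mul, doubleMul_eq, rep_tmul, Module.End.mul_apply,
    _root_.map_one, Module.End.one_apply, ← P.rep_apply_one (P.exchange _), ← repB_mul_repA]
  simp

theorem star_inlA (a : A) : star (he.inlA a) = he.inlA (star a) := by
  rw [inlA_apply, ← he.map_star, doubleStar_tmul, ← he.inrB_mul_inlA, star_one,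
    _root_.map_one, one_mul]

theorem star_inrB (b : B) : star (he.inrB b) = he.inrB (star b) := by
  rw [inrB_apply, ← he.map_star, doubleStar_tmul, ← he.inrB_mul_inlA, star_one,
    _root_.map_one, mul_one]

theorem exchangeRelation : P.ExchangeRelation he.inlA he.inrB := by
  intro p q i j
  simp only [inrB_mul_inlA, exchange_matCoeff, map_sum, map_smul, inlA_mul_inrB]
  calc _ = ∑ n, ∑ m, ∑ s, ∑ l, ∑ r, ∑ k, (P.form (matCoeff A p r) (matCoeff B k j) *
        P.form (matCoeff A r s) (antipode ℂ (matCoeff B l k))) •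
          P.form (matCoeff A n q) (matCoeff B i m) • e (matCoeff A s n ⊗ₜ matCoeff B m l) := by
        simp only [Finset.smul_sum, smul_smul, ← mul_assoc]
        exact Finset.sum_univ_reorder_six _
    _ = _ := by
        simp only [← Finset.sum_smul, sum_form_mul_form_antipode, ite_smul, zero_smul, one_smul]
        simp

/-- The embedding `a ↦ ∑ (a₍₂₎, 1) ⊗ (a₍₁₎, 1)`, the comultiplication of the quantum double on
`A`. -/
noncomputable def comulA : A →ₐ[ℂ] H ⊗[ℂ] H :=
  (Algebra.TensorProduct.map he.inlA he.inlA).comp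
    ((Algebra.TensorProduct.comm ℂ A A).toAlgHom.comp (Bialgebra.comulAlgHom ℂ A))

/-- The embedding `b ↦ ∑ (1, b₍₁₎) ⊗ (1, b₍₂₎)`, the comultiplication of the quantum double on
`B`. -/
noncomputable def comulB : B →ₐ[ℂ] H ⊗[ℂ] H :=
  (Algebra.TensorProduct.map he.inrB he.inrB).comp (Bialgebra.comulAlgHom ℂ B)

theorem comulA_matCoeff (p q : Fin (Module.finrank ℂ A)) :
    he.comulA (matCoeff A p q) =
      ∑ r, he.inlA (matCoeff A r q) ⊗ₜ he.inlA (matCoeff A p r) := by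
  simp [comulA]

theorem comulB_matCoeff (i j : Fin (Module.finrank ℂ B)) :
    he.comulB (matCoeff B i j) =
      ∑ k, he.inrB (matCoeff B i k) ⊗ₜ he.inrB (matCoeff B k j) := by
  simp [comulB]

/-- The comultiplication respects the commutation relation: in `H ⊗ H` the relation of `H` is used
in the second leg and then in the first. -/
theorem exchangeRelation_comul : P.ExchangeRelation he.comulA he.comulB := by
  intro p q i j
  have h := he.exchangeRelation
  calc _ = ∑ l, ∑ s, (he.inrB (matCoeff B i l) * he.inlA (matCoeff A s q)) ⊗ₜ[ℂ]
        ∑ r, ∑ k, P.form (matCoeff A p r) (matCoeff B k j) •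
          (he.inrB (matCoeff B l k) * he.inlA (matCoeff A r s)) := by
        simp only [comulA_matCoeff, comulB_matCoeff, Finset.sum_mul_sum,
          Algebra.TensorProduct.tmul_mul_tmul, Finset.smul_sum, TensorProduct.tmul_sum,
          TensorProduct.tmul_smul]
        rw [Finset.sum_univ_pair_comm]
    _ = ∑ l, ∑ s, (he.inrB (matCoeff B i l) * he.inlA (matCoeff A s q)) ⊗ₜ[ℂ]
        ∑ r, ∑ k, P.form (matCoeff A r s) (matCoeff B l k) •
          (he.inlA (matCoeff A p r) * he.inrB (matCoeff B k j)) := by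
        refine Finset.sum_congr rfl fun l _ => Finset.sum_congr rfl fun s _ => ?_
        rw [h]
    _ = ∑ r, ∑ k, (∑ s, ∑ l, P.form (matCoeff A r s) (matCoeff B l k) •
          (he.inrB (matCoeff B i l) * he.inlA (matCoeff A s q))) ⊗ₜ[ℂ]
            (he.inlA (matCoeff A p r) * he.inrB (matCoeff B k j)) := by
        simp only [TensorProduct.tmul_sum, TensorProduct.sum_tmul,
          TensorProduct.tmul_smul, TensorProduct.smul_tmul']
        rw [Finset.sum_univ_pair_comm]
        exact Finset.sum_congr rfl fun r _ => Finset.sum_congr rfl fun k _ => Finset.sum_comm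
    _ = _ := by
        simp only [h _ _ _ _, comulA_matCoeff, comulB_matCoeff, Finset.sum_mul_sum,
          Algebra.TensorProduct.tmul_mul_tmul, Finset.smul_sum, TensorProduct.sum_tmul,
          TensorProduct.smul_tmul']
        rw [Finset.sum_univ_pair_comm]

end IsDoubleAlgIso

end DoubleAlgebra

end HopfPairing

namespace HopfPairing.IsDoubleAlgIso

variable {A : Type u} {B : Type v} [FiniteHopfCStarAlgebra A] [FiniteHopfCStarAlgebra B]
  {P : HopfPairing A B} {H : Type*} [CStarAlgebra H] {e : A ⊗[ℂ] B ≃ₗ[ℂ] H}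
  (he : P.IsDoubleAlgIso e)

/-- Linear maps on `H` are determined by their values on products of matrix coefficients. -/
theorem linearMap_ext {M : Type*} [AddCommMonoid M] [Module ℂ M] {f g : H →ₗ[ℂ] M}
    (e : A ⊗[ℂ] B ≃ₗ[ℂ] H) (h : ∀ p q i j, f (e (matCoeff A p q ⊗ₜ matCoeff B i j)) =
      g (e (matCoeff A p q ⊗ₜ matCoeff B i j))) : f = g := by
  have : f ∘ₗ e.toLinearMap = g ∘ₗ e.toLinearMap :=
    TensorProduct.ext (LinearMap.ext_matCoeff fun p q => LinearMap.ext_matCoeff fun i j =>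
      h p q i j)
  ext x
  simpa using LinearMap.congr_fun this (e.symm x)

/-- The comultiplication of the quantum double, transported to `H`. -/
noncomputable def comulMap (P : HopfPairing A B) (e : A ⊗[ℂ] B ≃ₗ[ℂ] H) : H →ₗ[ℂ] H ⊗[ℂ] H :=
  TensorProduct.map e.toLinearMap e.toLinearMap ∘ₗ P.doubleComul ∘ₗ e.symm.toLinearMap

/-- The counit of the quantum double, transported to `H`. -/
noncomputable def counitMap (P : HopfPairing A B) (e : A ⊗[ℂ] B ≃ₗ[ℂ] H) : H →ₗ[ℂ] ℂ :=
  P.doubleCounit ∘ₗ e.symm.toLinearMap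

/-- The antipode of the quantum double, transported to `H`. -/
noncomputable def antipodeMap (P : HopfPairing A B) (e : A ⊗[ℂ] B ≃ₗ[ℂ] H) : H →ₗ[ℂ] H :=
  e.toLinearMap ∘ₗ P.doubleAntipode ∘ₗ e.symm.toLinearMap

theorem comulMap_matCoeff (p q : Fin (Module.finrank ℂ A)) (i j : Fin (Module.finrank ℂ B)) :
    comulMap P e (e (matCoeff A p q ⊗ₜ matCoeff B i j)) =
      ∑ r, ∑ k, e (matCoeff A r q ⊗ₜ matCoeff B i k) ⊗ₜ[ℂ]
        e (matCoeff A p r ⊗ₜ matCoeff B k j) := by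
  rw [Finset.sum_comm]
  simp [comulMap, doubleComul, comulOp, TensorProduct.sum_tmul, TensorProduct.tmul_sum]

theorem counitMap_tmul (a : A) (b : B) :
    counitMap P e (e (a ⊗ₜ b)) = counit (R := ℂ) a * counit (R := ℂ) b := by
  simp [counitMap, doubleCounit]

theorem antipodeMap_tmul (a : A) (b : B) :
    antipodeMap P e (e (a ⊗ₜ b)) = he.inrB (antipode ℂ b) * he.inlA (antipode ℂ a) := by
  simp [antipodeMap, doubleAntipode, inrB_mul_inlA]

theorem liftDouble_comul (x : A ⊗[ℂ] B) :
    liftDouble he.comulA he.comulB x = comulMap P e (e x) := by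
  have : liftDouble he.comulA he.comulB = comulMap P e ∘ₗ e.toLinearMap := by
    refine TensorProduct.ext (LinearMap.ext_matCoeff fun p q =>
      LinearMap.ext_matCoeff fun i j => ?_)
    change liftDouble _ _ (matCoeff A p q ⊗ₜ matCoeff B i j) =
      comulMap P e (e (matCoeff A p q ⊗ₜ matCoeff B i j))
    simp only [liftDouble_tmul, comulA_matCoeff, comulB_matCoeff, comulMap_matCoeff,
      Finset.sum_mul_sum, Algebra.TensorProduct.tmul_mul_tmul, inlA_mul_inrB]
  exact LinearMap.congr_fun this x

theorem comulMap_mul (he : P.IsDoubleAlgIso e) (x y : H) :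
    comulMap P e (x * y) = comulMap P e x * comulMap P e y := by
  obtain ⟨x, rfl⟩ := e.surjective x
  obtain ⟨y, rfl⟩ := e.surjective y
  rw [← he.map_mul, ← he.liftDouble_comul, ← he.liftDouble_comul, ← he.liftDouble_comul,
    he.exchangeRelation_comul.map_doubleMul]

theorem comulMap_one (he : P.IsDoubleAlgIso e) : comulMap P e (1 : H) = 1 := by
  rw [← he.map_one, ← he.liftDouble_comul, liftDouble_tmul, _root_.map_one, _root_.map_one,
    one_mul]

theorem exchangeRelation_counit (P : HopfPairing A B) :
    P.ExchangeRelation (Bialgebra.counitAlgHom ℂ A) (Bialgebra.counitAlgHom ℂ B) := by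
  intro p q i j
  simp

theorem liftDouble_counit (x : A ⊗[ℂ] B) :
    liftDouble (Bialgebra.counitAlgHom ℂ A) (Bialgebra.counitAlgHom ℂ B) x =
      counitMap P e (e x) := by
  induction x with
  | zero => simp
  | add x y hx hy => simp only [map_add, hx, hy]
  | tmul a b => simp [counitMap_tmul]

theorem counitMap_mul (he : P.IsDoubleAlgIso e) (x y : H) :
    counitMap P e (x * y) = counitMap P e x * counitMap P e y := by
  obtain ⟨x, rfl⟩ := e.surjective x
  obtain ⟨y, rfl⟩ := e.surjective y
  rw [← he.map_mul, ← liftDouble_counit, ← liftDouble_counit, ← liftDouble_counit,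
    (exchangeRelation_counit P).map_doubleMul]

theorem counitMap_one (he : P.IsDoubleAlgIso e) : counitMap P e (1 : H) = 1 := by
  rw [← he.map_one, counitMap_tmul]
  simp

/-- The coalgebra structure of the quantum double. -/
@[reducible]
noncomputable def coalgebra (P : HopfPairing A B) (e : A ⊗[ℂ] B ≃ₗ[ℂ] H) : Coalgebra ℂ H where
  comul := comulMap P e
  counit := counitMap P e
  coassoc := by
    refine linearMap_ext e fun p q i j => ?_
    simp only [LinearMap.comp_apply, comulMap_matCoeff, map_sum, LinearMap.rTensor_tmul,
      LinearMap.lTensor_tmul, TensorProduct.sum_tmul, TensorProduct.tmul_sum,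
      LinearEquiv.coe_coe, TensorProduct.assoc_tmul]
    rw [Finset.sum_univ_pair_comm]
  rTensor_counit_comp_comul := by
    refine linearMap_ext e fun p q i j => ?_
    simp only [LinearMap.comp_apply, comulMap_matCoeff, map_sum, LinearMap.rTensor_tmul,
      counitMap_tmul, counit_matCoeff]
    simp [TensorProduct.ite_tmul]
  lTensor_counit_comp_comul := by
    refine linearMap_ext e fun p q i j => ?_
    simp only [LinearMap.comp_apply, comulMap_matCoeff, map_sum, LinearMap.lTensor_tmul,
      counitMap_tmul, counit_matCoeff]
    simp [TensorProduct.tmul_ite]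

/-- The Hopf algebra structure of the quantum double. -/
@[reducible]
noncomputable def hopfAlgebra : HopfAlgebra ℂ H :=
  { toBialgebra := @Bialgebra.mk' ℂ H _ _ _ (coalgebra P e) (counitMap_one he)
      (fun {x y} => counitMap_mul he x y) he.comulMap_one (fun {x y} => he.comulMap_mul x y)
    antipode := antipodeMap P e
    mul_antipode_rTensor_comul := by
      change _ ∘ₗ _ ∘ₗ comulMap P e = _ ∘ₗ counitMap P e
      refine linearMap_ext e fun p q i j => ?_
      simp only [LinearMap.comp_apply, comulMap_matCoeff, map_sum, LinearMap.rTensor_tmul,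
        counitMap_tmul, counit_matCoeff, LinearMap.mul'_apply, he.antipodeMap_tmul]
      simp only [← he.inlA_mul_inrB, mul_assoc]
      rw [Finset.sum_comm]
      simp only [← mul_assoc (he.inlA _), ← _root_.map_mul, ← Finset.mul_sum, ← Finset.sum_mul,
        ← map_sum, sum_antipode_mul_matCoeff_swap]
      split_ifs <;> simp [← _root_.map_mul, ← map_sum, sum_antipode_mul_matCoeff, *]
    mul_antipode_lTensor_comul := by
      change _ ∘ₗ _ ∘ₗ comulMap P e = _ ∘ₗ counitMap P e
      refine linearMap_ext e fun p q i j => ?_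
      simp only [LinearMap.comp_apply, comulMap_matCoeff, map_sum, LinearMap.lTensor_tmul,
        counitMap_tmul, counit_matCoeff, LinearMap.mul'_apply, he.antipodeMap_tmul]
      simp only [← he.inlA_mul_inrB, mul_assoc]
      simp only [← mul_assoc (he.inrB _), ← _root_.map_mul, ← Finset.mul_sum, ← Finset.sum_mul,
        ← map_sum, sum_mul_antipode_matCoeff]
      split_ifs <;> simp [← _root_.map_mul, ← map_sum, sum_matCoeff_mul_antipode_swap, *] }

theorem comulMap_star (he : P.IsDoubleAlgIso e) (x : H) :
    comulMap P e (star x) = star (comulMap P e x) := by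
  have hA : ∀ a, star (he.comulA a) = he.comulA (star a) := by
    intro a
    simp only [comulA, AlgHom.comp_apply, Bialgebra.comulAlgHom_apply,
      FiniteHopfCStarAlgebra.comul_star]
    generalize comul (R := ℂ) a = z
    induction z with
    | zero => simp
    | add x y hx hy => simp only [map_add, star_add, hx, hy]
    | tmul x y => simp [star_inlA]
  have hB : ∀ b, star (he.comulB b) = he.comulB (star b) := by
    intro b
    simp only [comulB, AlgHom.comp_apply, Bialgebra.comulAlgHom_apply,
      FiniteHopfCStarAlgebra.comul_star]
    generalize comul (R := ℂ) b = z
    induction z with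
    | zero => simp
    | add x y hx hy => simp only [map_add, star_add, hx, hy]
    | tmul x y => simp [star_inrB]
  obtain ⟨x, rfl⟩ := e.surjective x
  induction x with
  | zero => simp
  | add x y hx hy => simp only [map_add, star_add, hx, hy]
  | tmul a b =>
    have h1 : ∀ a, comulMap P e (he.inlA a) = he.comulA a := fun a => by
      rw [inlA_apply, ← liftDouble_comul, liftDouble_tmul, _root_.map_one, mul_one]
    have h2 : ∀ b, comulMap P e (he.inrB b) = he.comulB b := fun b => by
      rw [inrB_apply, ← liftDouble_comul, liftDouble_tmul, _root_.map_one, one_mul]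
    rw [← he.inlA_mul_inrB, star_mul, he.comulMap_mul, he.comulMap_mul, star_mul, star_inlA,
      star_inrB, h1, h2, h1, h2, hA, hB]

theorem counitMap_star (he : P.IsDoubleAlgIso e) (x : H) :
    counitMap P e (star x) = star (counitMap P e x) := by
  obtain ⟨x, rfl⟩ := e.surjective x
  induction x with
  | zero => simp
  | add x y hx hy => simp only [map_add, star_add, hx, hy]
  | tmul a b =>
    rw [← he.inlA_mul_inrB, star_mul, counitMap_mul he, counitMap_mul he, star_mul, star_inlA,
      star_inrB]
    simp only [inlA_apply, inrB_apply, counitMap_tmul, FiniteHopfCStarAlgebra.counit_star]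
    simp

theorem star_antipodeMap_star_antipodeMap (he : P.IsDoubleAlgIso e) (x : H) :
    star (antipodeMap P e (star (antipodeMap P e x))) = x := by
  obtain ⟨x, rfl⟩ := e.surjective x
  induction x with
  | zero => simp
  | add x y hx hy => simp only [map_add, star_add, hx, hy]
  | tmul a b =>
    rw [he.antipodeMap_tmul, star_mul, star_inlA, star_inrB, inlA_mul_inrB, he.antipodeMap_tmul,
      star_mul, star_inlA, star_inrB]
    simp only [star_antipode, antipode_antipode, star_star, inlA_mul_inrB]

/-- The quantum double as a finite Hopf C*-algebra, for a given C*-norm. -/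
@[reducible]
noncomputable def finiteHopfCStarAlgebra : FiniteHopfCStarAlgebra H :=
  { (inferInstance : CStarAlgebra H), he.hopfAlgebra with
    finite_dim := e.finiteDimensional
    comul_star := he.comulMap_star
    counit_star := counitMap_star he
    star_antipode_star_antipode := he.star_antipodeMap_star_antipodeMap }

theorem isDoubleIso : @IsDoubleIso A B _ _ P H he.finiteHopfCStarAlgebra e :=
  letI := he.finiteHopfCStarAlgebra
  { map_mul := he.map_mul
    map_one := he.map_one
    map_star := he.map_star
    map_comul := fun x => by
      change _ = comulMap P e (e x)
      simp [comulMap]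
    map_counit := fun x => by
      change _ = counitMap P e (e x)
      simp [counitMap]
    map_antipode := fun x => by
      change _ = antipodeMap P e (e x)
      simp [antipodeMap] }

end HopfPairing.IsDoubleAlgIso

/-! ### The GNS representation of the quantum double -/

namespace HopfPairing

variable {A : Type u} {B : Type v} [FiniteHopfCStarAlgebra A] [FiniteHopfCStarAlgebra B]
  (P : HopfPairing A B) {φ : A →ₗ[ℂ] ℂ} {ψ : B →ₗ[ℂ] ℂ} (hθ : PosDef (tensorFunctional φ ψ))

instance : CompleteSpace (GNSSpace hθ) := FiniteDimensional.complete ℂ _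

/-- The regular representation on the Hilbert space of `φ ⊗ ψ`. -/
noncomputable def gnsRep : A ⊗[ℂ] B →ₗ[ℂ] (GNSSpace hθ →L[ℂ] GNSSpace hθ) :=
  LinearMap.toContinuousLinearMap.toLinearMap ∘ₗ (GNSSpace.equiv hθ).conj.toLinearMap ∘ₗ P.rep

theorem gnsRep_apply (x y : A ⊗[ℂ] B) :
    P.gnsRep hθ x (GNSSpace.equiv hθ y) = GNSSpace.equiv hθ (P.rep x y) := by
  simp [gnsRep, LinearEquiv.conj_apply]

theorem gnsRep_doubleMul (x y : A ⊗[ℂ] B) :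
    P.gnsRep hθ (P.doubleMul x y) = P.gnsRep hθ x * P.gnsRep hθ y := by
  refine GNSSpace.clm_ext hθ fun z => ?_
  rw [mul_apply_eq_comp, gnsRep_apply, gnsRep_apply, gnsRep_apply, rep_doubleMul,
    Module.End.mul_apply]

theorem gnsRep_one : P.gnsRep hθ (1 ⊗ₜ 1) = 1 := by
  refine GNSSpace.clm_ext hθ fun z => ?_
  rw [gnsRep_apply, rep_tmul, map_one, map_one]
  rfl

theorem gnsRep_doubleStar (hφ : IsInvariantFunctional φ) (x : A ⊗[ℂ] B) :
    P.gnsRep hθ (P.doubleStar x) = star (P.gnsRep hθ x) := by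
  rw [ContinuousLinearMap.star_eq_adjoint, ContinuousLinearMap.eq_adjoint_iff]
  intro y z
  obtain ⟨y, rfl⟩ := (GNSSpace.equiv hθ).surjective y
  obtain ⟨z, rfl⟩ := (GNSSpace.equiv hθ).surjective z
  rw [gnsRep_apply, gnsRep_apply]
  change tensorFunctional φ ψ (star (P.rep _ y) * z) = tensorFunctional φ ψ (star y * P.rep x z)
  rw [← hθ.star_apply, ← P.isAdjoint_rep hφ x z y, hθ.star_apply]

theorem gnsRep_injective : Function.Injective (P.gnsRep hθ) := by
  intro x y h
  have := congrArg (fun T => T (GNSSpace.equiv hθ (1 ⊗ₜ 1))) h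
  simpa [gnsRep_apply, rep_apply_one] using this

/-- The image of the quantum double under its regular representation. -/
noncomputable def gnsImage (hφ : IsInvariantFunctional φ) :
    StarSubalgebra ℂ (GNSSpace hθ →L[ℂ] GNSSpace hθ) where
  carrier := LinearMap.range (P.gnsRep hθ)
  mul_mem' := by
    rintro _ _ ⟨x, rfl⟩ ⟨y, rfl⟩
    exact ⟨_, P.gnsRep_doubleMul hθ x y⟩
  add_mem' := fun hx hy => add_mem hx hy
  algebraMap_mem' := fun c => by
    rw [Algebra.algebraMap_eq_smul_one, ← P.gnsRep_one hθ]
    exact Submodule.smul_mem _ c ⟨_, rfl⟩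
  star_mem' := by
    rintro _ ⟨x, rfl⟩
    exact ⟨_, P.gnsRep_doubleStar hθ hφ x⟩

instance isClosed_gnsImage (hφ : IsInvariantFunctional φ) :
    IsClosed (P.gnsImage hθ hφ : Set (GNSSpace hθ →L[ℂ] GNSSpace hθ)) :=
  (LinearMap.range (P.gnsRep hθ)).closed_of_finiteDimensional

/-- The identification of the quantum double with its image in the regular representation. -/
noncomputable def gnsEquiv (hφ : IsInvariantFunctional φ) : A ⊗[ℂ] B ≃ₗ[ℂ] P.gnsImage hθ hφ :=
  LinearEquiv.ofInjective (P.gnsRep hθ) (P.gnsRep_injective hθ)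

theorem isDoubleAlgIso_gnsEquiv (hφ : IsInvariantFunctional φ) :
    P.IsDoubleAlgIso (P.gnsEquiv hθ hφ) where
  map_mul x y := Subtype.ext (P.gnsRep_doubleMul hθ x y)
  map_one := Subtype.ext (P.gnsRep_one hθ)
  map_star x := Subtype.ext (P.gnsRep_doubleStar hθ hφ x)

variable {H : Type*} [CStarAlgebra H] {e : A ⊗[ℂ] B ≃ₗ[ℂ] H}

variable {P} in
/-- In the quantum double, `θ(y^* x)` for `θ = φ ⊗ ψ` is the same as in the tensor product. -/
theorem IsDoubleAlgIso.tensorFunctional_star_mul (he : P.IsDoubleAlgIso e)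
    (hφ : IsInvariantFunctional φ) (x y : H) :
    tensorFunctional φ ψ (e.symm (star y * x)) =
      tensorFunctional φ ψ (star (e.symm y) * e.symm x) := by
  have h : star y * x = e (P.rep (P.doubleStar (e.symm y)) (e.symm x)) := by
    rw [← doubleMul_eq, he.map_mul, he.map_star, e.apply_symm_apply, e.apply_symm_apply]
  have h2 := P.isAdjoint_rep (ψ := ψ) hφ (e.symm y) (1 ⊗ₜ 1) (e.symm x)
  rw [rep_apply_one, ← Algebra.TensorProduct.one_def, star_one, one_mul] at h2
  rw [h, e.symm_apply_apply, h2]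

variable {P} in
theorem IsDoubleAlgIso.isFaithfulPositive (he : P.IsDoubleAlgIso e)
    (hθ : PosDef (tensorFunctional φ ψ))
    (hφ : IsInvariantFunctional φ) :
    IsFaithfulPositive (tensorFunctional φ ψ ∘ₗ e.symm.toLinearMap) := by
  refine ⟨fun x => ?_, fun x hx => ?_⟩
  · rw [LinearMap.comp_apply, LinearEquiv.coe_coe, he.tensorFunctional_star_mul hφ]
    exact hθ.1 _
  · rw [LinearMap.comp_apply, LinearEquiv.coe_coe, he.tensorFunctional_star_mul hφ] at hx
    exact e.symm.map_eq_zero_iff.1 (hθ.2 _ hx)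

variable {P} in
/-- The GNS representation of `φ ⊗ ψ` is the regular representation of the quantum double. -/
noncomputable def IsDoubleAlgIso.gnsRepresentation (he : P.IsDoubleAlgIso e)
    (hφ : IsInvariantFunctional φ) :
    GNSRepresentation (tensorFunctional φ ψ ∘ₗ e.symm.toLinearMap) (GNSSpace hθ) where
  toK := e.symm ≪≫ₗ GNSSpace.equiv hθ
  π :=
    { AlgHom.ofLinearMap (P.gnsRep hθ ∘ₗ e.symm.toLinearMap)
        (by
          change P.gnsRep hθ (e.symm 1) = 1
          rw [← he.map_one, e.symm_apply_apply, gnsRep_one])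
        (fun x y => by
          change P.gnsRep hθ (e.symm _) = P.gnsRep hθ (e.symm _) * P.gnsRep hθ (e.symm _)
          rw [← gnsRep_doubleMul]
          congr 1
          rw [LinearEquiv.symm_apply_eq, he.map_mul, e.apply_symm_apply, e.apply_symm_apply]) with
      map_star' := fun x => by
        change P.gnsRep hθ (e.symm _) = star (P.gnsRep hθ (e.symm _))
        rw [← P.gnsRep_doubleStar hθ hφ]
        congr 1
        rw [LinearEquiv.symm_apply_eq, he.map_star, e.apply_symm_apply] }
  inner_toK x y := (he.tensorFunctional_star_mul hφ x y).symm
  π_toK d x := by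
    change P.gnsRep hθ (e.symm d) (GNSSpace.equiv hθ (e.symm x)) =
      GNSSpace.equiv hθ (e.symm (d * x))
    rw [gnsRep_apply, ← doubleMul_eq]
    congr 1
    rw [LinearEquiv.eq_symm_apply, he.map_mul, e.apply_symm_apply, e.apply_symm_apply]

variable {P} in
/-- The GNS representation is injective, hence isometric; so the C*-norm of `H` is the GNS norm of
every faithful `φ ⊗ ψ`. -/
theorem IsDoubleAlgIso.norm_gnsRepresentation (he : P.IsDoubleAlgIso e)
    (hφ : IsInvariantFunctional φ) (d : H) : ‖d‖ = ‖(he.gnsRepresentation hθ hφ).π d‖ :=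
  (NonUnitalStarAlgHom.norm_map (he.gnsRepresentation hθ hφ).π
    ((P.gnsRep_injective hθ).comp e.symm.injective) d).symm

end HopfPairing

theorem theorem3p8 {A : Type u} {B : Type v} [FiniteHopfCStarAlgebra A]
    [FiniteHopfCStarAlgebra B] (P : HopfPairing A B) (hP : P.Nondegenerate) :
    (∃ φ : A →ₗ[ℂ] ℂ, IsInvariantIntegral φ) ∧
    (∃ φ : B →ₗ[ℂ] ℂ, IsInvariantIntegral φ) ∧
    ∃ (H : Type (max u v)) (_ : FiniteHopfCStarAlgebra H) (e : A ⊗[ℂ] B ≃ₗ[ℂ] H),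
      P.IsDoubleIso e ∧
      ∀ (φA : A →ₗ[ℂ] ℂ) (φB : B →ₗ[ℂ] ℂ), IsInvariantIntegral φA → IsInvariantIntegral φB →
        IsFaithfulPositive (tensorFunctional φA φB ∘ₗ e.symm.toLinearMap) ∧
        ∃ (K : Type (max u v)) (_ : NormedAddCommGroup K) (_ : InnerProductSpace ℂ K)
          (_ : CompleteSpace K)
          (ρ : GNSRepresentation (tensorFunctional φA φB ∘ₗ e.symm.toLinearMap) K),
          ∀ d : H, ‖d‖ = ‖ρ.π d‖ := by
  refine ⟨⟨haar A, haar_isInvariantIntegral⟩, ⟨haar B, haar_isInvariantIntegral⟩, ?_⟩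
  have hA : IsInvariantFunctional (haar A) := haar_isInvariantIntegral.toIsInvariantFunctional
  have hθ : PosDef (tensorFunctional (haar A) (haar B)) :=
    haar_posDef.tensorFunctional haar_posDef
  have he := P.isDoubleAlgIso_gnsEquiv hθ hA
  refine ⟨P.gnsImage hθ hA, he.finiteHopfCStarAlgebra, P.gnsEquiv hθ hA, he.isDoubleIso, ?_⟩
  intro φA φB hφA hφB
  have hθ' : PosDef (tensorFunctional φA φB) := hφA.posDef.tensorFunctional hφB.posDef
  exact ⟨he.isFaithfulPositive hθ' hφA.toIsInvariantFunctional, GNSSpace hθ', inferInstance,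
    inferInstance, inferInstance, he.gnsRepresentation hθ' hφA.toIsInvariantFunctional,
    he.norm_gnsRepresentation hθ' hφA.toIsInvariantFunctional⟩
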